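/- Conventions. Let $\underline{C}$ be a triangulated category, let $t=(\underline{C}^{t\le 0},\underline{C}^{t\ge 0})$ be a bounded $t$-structure (with $\underline{C}^{t\le n}=\underline{C}^{t\le 0}[-n]$, truncations $\tau_{\le n},\tau_{\ge n}$, heart $\mathcal H=\underline{C}^{t\le 0}\cap \underline{C}^{t\ge 0}$, and cohomology $X^{\tau=j}=\tau_{\ge 0}\tau_{\le 0}(X[j])\in\mathcal H$), and let $w$ be a bounded weight structure on $\underline{C}$: classes $\underline{C}^{w\le 0},\underline{C}^{w\ge 0}$ closed under retracts such that, with $\underline{C}^{w\le n}=\underline{C}^{w\le 0}[n]$ and $\underline{C}^{w\ge n}=\underline{C}^{w\ge 0}[n]$, one has $\underline{C}^{w\le 0}\subseteq \underline{C}^{w\le 1}$, $\underline{C}^{w\ge 1}\subseteq \underline{C}^{w\ge 0}$, there are no non-zero morphisms from $\underline{C}^{w\le 0}$ to $\underline{C}^{w\ge 1}$, and every $X$ lies in a distinguished triangle $A\to X\to B\to A[1]$ with $A\in \underline{C}^{w\le 0}$, $B\in\underline{C}^{w\ge 1}$. Bounded means that every object lies in $\underline{C}^{t\le n}\cap \underline{C}^{t\ge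 m}$ (resp. in $\underline{C}^{w\le n}\cap\underline{C}^{w\ge m}$) for some $n,m\in\mathbb Z$. Say that $t$ is transversal to $w$ if for every $X\in\mathcal H$ and $i\in\mathbb Z$ there is a distinguished triangle $A\to X\to B\to A[1]$ with $A\in\mathcal H\cap \underline{C}^{w\le i}$ and $B\in\mathcal H\cap\underline{C}^{w\ge i+1}$. Put $\underline{A}_i=\mathcal H\cap\underline{C}^{w\le i}\cap\underline{C}^{w\ge i}$. Proposition 1.9. Suppose that $t$ is transversal to $w$. Then there exists a filtration of the identity functor of $\mathcal H$ by subfunctors $W_{\le i}$ ($i\in\mathbb Z$), increasing, separated ($\bigcap_i W_{\le i}X=0$) and exhaustive ($\bigcup_i W_{\le i}X=X$), such that $W_{\le i}X/W_{\le i-1}X\in\underline{A}_i$ for all $X\in\mathcal H$, $i\in\mathbb Z$. For any such filtration put $W_{\ge i}X=X/W_{\le i-1}X$. For every $i\in\mathbb Z$ the following statements hold. I.1. The functors $\tau_{\le i}$ and $\tau_{\ge i}$ map $\underline{C}^{w\le 0}$ into itself and $\underline{C}^{w\ge 0}$ into itself. I.2. For $X\in\underline{C}$: $X\in\underline{C}^{w\le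 i}$ if and only if $W_{\le i+j}(X^{\tau=j})=X^{\tau=j}$ for all $j\in\mathbb Z$; and $X\in\underline{C}^{w\ge i}$ if and only if $W_{\le i+j-1}(X^{\tau=j})=0$ for all $j\in\mathbb Z$. II.1. The functor $W_{\le i}:\mathcal H\to\mathcal H$ is exact, takes values in $\underline{C}^{w\le i}\cap\mathcal H$, and is right adjoint to the embedding $\underline{C}^{w\le i}\cap\mathcal H\to\mathcal H$, the counit being the inclusion $W_{\le i}X\to X$. II.2. The functor $W_{\ge i+1}:\mathcal H\to\mathcal H$ is exact, takes values in $\underline{C}^{w\ge i+1}\cap\mathcal H$, and is left adjoint to the embedding $\underline{C}^{w\ge i+1}\cap\mathcal H\to\mathcal H$, the unit being the projection $X\to W_{\ge i+1}X$. III.1. The functors $Gr_i:X\mapsto W_{\ge i}(W_{\le i}X)$ and $Gr'_i:X\mapsto W_{\le i}(W_{\ge i}X)$ are exact projections of $\mathcal H$ onto $\underline{A}_i$ (i.e. they take values in $\underline{A}_i$ and their restrictions to $\underline{A}_i$ are isomorphic to the identity). They are canonically isomorphic: there is an isomorphism of functors $Gr_i\cong Gr'_i$ such that for every $X$ the composite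 $W_{\le i}X\to Gr_iX\cong Gr'_iX\to W_{\ge i}X$ equals $W_{\le i}X\to X\to W_{\ge i}X$. Moreover, $Gr_i(X)\cong W_{\le i}X/W_{\le i-1}X$, functorially in $X$ and compatibly with the projections from $W_{\le i}X$. III.2. For $X\in\mathcal H$: $X\in\underline{C}^{w\le i}$ if and only if $Gr_j(X)=0$ for all $j>i$; and $X\in\underline{C}^{w\ge i}$ if and only if $Gr_j(X)=0$ for all $j<i$. -/

import Mathlib

open CategoryTheory Limits Pretriangulated Triangulated

universe v u

namespace WeightAndT

section WeightStructures

variable (C : Type u) [Category.{v} C] [Preadditive C] [HasZeroObject C] [HasShift C ℤ]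
  [∀ n : ℤ, (shiftFunctor C n).Additive] [Pretriangulated C]

/-- A weight structure on a triangulated category, in the sign convention for which
`C^{w ≤ i} = C^{w ≤ 0}[i]`, `C^{w ≥ i} = C^{w ≥ 0}[i]`: the classes `C^{w ≤ n}` and `C^{w ≥ n}`
are closed under retracts (in particular under isomorphisms), `C^{w ≤ 0} ⊆ C^{w ≤ 1}`,
`C^{w ≥ 1} ⊆ C^{w ≥ 0}`, there are no non-zero morphisms from `C^{w ≤ 0}` to `C^{w ≥ 1}`,
and any object admits a weight decomposition. (Stability of these classes under finite direct
sums is a consequence of these axioms.) -/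
structure WeightStructure where
  /-- the class `C^{w ≤ n}` -/
  le (n : ℤ) : ObjectProperty C
  /-- the class `C^{w ≥ n}` -/
  ge (n : ℤ) : ObjectProperty C
  le_isStableUnderRetracts (n : ℤ) : (le n).IsStableUnderRetracts
  ge_isStableUnderRetracts (n : ℤ) : (ge n).IsStableUnderRetracts
  le_shift (n a n' : ℤ) (h : n + a = n') (X : C) (hX : le n X) : le n' (X⟦a⟧)
  ge_shift (n a n' : ℤ) (h : n + a = n') (X : C) (hX : ge n X) : ge n' (X⟦a⟧)
  le_zero_le : le 0 ≤ le 1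
  ge_one_le : ge 1 ≤ ge 0
  zero ⦃X Y : C⦄ (f : X ⟶ Y) (hX : le 0 X) (hY : ge 1 Y) : f = 0
  exists_triangle_zero_one (X : C) : ∃ (A B : C) (_ : le 0 A) (_ : ge 1 B)
    (f : A ⟶ X) (g : X ⟶ B) (h : B ⟶ A⟦(1 : ℤ)⟧), Triangle.mk f g h ∈ distTriang C

variable {C}

/-- A weight structure is bounded if every object belongs to some `C^{w ≤ n}` and to some
`C^{w ≥ m}`. -/
def WeightStructure.IsBounded (w : WeightStructure C) : Prop :=
  ∀ X : C, (∃ n : ℤ, w.le n X) ∧ ∃ m : ℤ, w.ge m X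

/-- A t-structure is bounded if every object belongs to some `C^{t ≤ n}` and to some
`C^{t ≥ m}`. -/
def IsBoundedT (t : TStructure C) : Prop :=
  ∀ X : C, (∃ n : ℤ, t.le n X) ∧ ∃ m : ℤ, t.ge m X

/-- `X` admits a nice decomposition at level `i`: a weight decomposition
`A ⟶ X ⟶ B ⟶ A[1]` with `A ∈ C^{w ≤ i}`, `B ∈ C^{w ≥ i + 1}`, all of whose terms `A`, `X`, `B`
lie in the heart of `t`. -/
def HasNiceDecomposition (t : TStructure C) (w : WeightStructure C) (i : ℤ) (X : C) : Prop :=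
  t.heart X ∧ ∃ (A B : C) (f : A ⟶ X) (g : X ⟶ B) (h : B ⟶ A⟦(1 : ℤ)⟧),
    Triangle.mk f g h ∈ distTriang C ∧ w.le i A ∧ w.ge (i + 1) B ∧ t.heart A ∧ t.heart B

/-- `t` is transversal to `w`: every object of the heart of `t` admits a nice decomposition
at every level. -/
def IsTransversal (t : TStructure C) (w : WeightStructure C) : Prop :=
  ∀ (X : C) (i : ℤ), t.heart X → HasNiceDecomposition t w i X

end WeightStructures

section Heart

variable {C : Type u} [Category.{v} C] [Preadditive C] [HasZeroObject C] [HasShift C ℤ]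
  [∀ n : ℤ, (shiftFunctor C n).Additive] [Pretriangulated C] [IsTriangulated C] (t : TStructure C)

/-- The heart of `t`, as a full subcategory. -/
abbrev Hrt : Type u := t.heart.FullSubcategory

instance heart_containsZero : t.heart.ContainsZero where
  exists_zero := ⟨_, isZero_zero C, (t.mem_heart_iff _).2 ⟨inferInstance, inferInstance⟩⟩

lemma heart_biprod (X Y : C) (hX : t.heart X) (hY : t.heart Y) : t.heart (X ⊞ Y) := by
  rw [t.mem_heart_iff] at hX hY ⊢
  exact ⟨t.isLE₂ _ (binaryBiproductTriangle_distinguished X Y) 0 hX.1 hY.1,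
    t.isGE₂ _ (binaryBiproductTriangle_distinguished X Y) 0 hX.2 hY.2⟩

instance heart_hasFiniteProducts : HasFiniteProducts (Hrt t) := by
  have : HasZeroObject (Hrt t) := inferInstance
  have : HasBinaryBiproducts (Hrt t) := ⟨fun X Y ↦
    HasBinaryBiproduct.mk
      { bicone :=
          { pt := ⟨X.obj ⊞ Y.obj, heart_biprod t _ _ X.property Y.property⟩
            fst := ObjectProperty.homMk biprod.fst
            snd := ObjectProperty.homMk biprod.snd
            inl := ObjectProperty.homMk biprod.inl
            inr := ObjectProperty.homMk biprod.inr
            inl_fst := by ext; simp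
            inl_snd := by ext; simp
            inr_fst := by ext; simp
            inr_snd := by ext; simp }
        isBilimit := isBinaryBilimitOfTotal _ (t.heart.ι.map_injective biprod.total) }⟩
  have : HasTerminal (Hrt t) := inferInstance
  exact hasFiniteProducts_of_has_binary_and_terminal

lemma heart_hom_eq_zero ⦃X Y : Hrt t⦄ ⦃n : ℤ⦄
    (f : t.heart.ι.obj X ⟶ (t.heart.ι.obj Y)⟦n⟧) (hn : n < 0) : f = 0 := by
  have hX := ((t.mem_heart_iff _).1 X.property).1
  have hY := ((t.mem_heart_iff _).1 Y.property).2
  exact t.zero_of_isLE_of_isGE f 0 (-n) (by lia) hX (t.isGE_shift Y.obj 0 n (-n))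

lemma heart_admissible :
    AbelianSubcategory.admissibleMorphism t.heart.ι = ⊤ := by
  ext X₁ X₂ f₁
  simp only [MorphismProperty.top_apply, iff_true]
  intro X₃ f₂ f₃ hT
  have h1 := (t.mem_heart_iff _).1 X₁.property
  have h2 := (t.mem_heart_iff _).1 X₂.property
  have := h1.1
  have := h1.2
  have := h2.1
  have := h2.2
  have a1 : t.IsLE (X₁.obj⟦(1 : ℤ)⟧) (-1) := t.isLE_shift X₁.obj 0 1 (-1)
  have a2 : t.IsGE (X₁.obj⟦(1 : ℤ)⟧) (-1) := t.isGE_shift X₁.obj 0 1 (-1)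
  have hT' := rot_of_distTriang _ hT
  have l3 : t.IsLE X₃ 0 := t.isLE₂ _ hT' 0 h2.1 (t.isLE_of_le (X₁.obj⟦(1 : ℤ)⟧) (-1) 0)
  have g3 : t.IsGE X₃ (-1) := t.isGE₂ _ hT' (-1) (t.isGE_of_ge X₂.obj (-1) 0) a2
  let K' := (t.truncLT 0).obj X₃
  have k1 : t.IsLE K' (-1) := t.isLE_truncLT_obj X₃ 0 (-1)
  have k2 : t.IsGE K' (-1) := by dsimp [K']; infer_instance
  have k3 : t.IsLE (K'⟦(-1 : ℤ)⟧) 0 := t.isLE_shift K' (-1) (-1) 0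
  have k4 : t.IsGE (K'⟦(-1 : ℤ)⟧) 0 := t.isGE_shift K' (-1) (-1) 0
  let K : Hrt t := ⟨K'⟦(-1 : ℤ)⟧, (t.mem_heart_iff _).2 ⟨k3, k4⟩⟩
  let Q : Hrt t := ⟨(t.truncGE 0).obj X₃,
    (t.mem_heart_iff _).2 ⟨by infer_instance, by infer_instance⟩⟩
  let e : (t.heart.ι.obj K)⟦(1 : ℤ)⟧ ≅ K' := (shiftEquiv C (1 : ℤ)).counitIso.app K'
  let δ : (t.truncGE 0).obj X₃ ⟶ K'⟦(1 : ℤ)⟧ := (t.truncGEδLT 0).app X₃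
  have hδ : (δ ≫ (shiftFunctor C (1 : ℤ)).map e.inv) ≫ (shiftFunctor C (1 : ℤ)).map e.hom = δ := by
    rw [Category.assoc, ← Functor.map_comp, e.inv_hom_id, CategoryTheory.Functor.map_id, Category.comp_id]
  refine ⟨K, Q, e.hom ≫ (t.truncLTι 0).app X₃, (t.truncGEπ 0).app X₃,
    δ ≫ (shiftFunctor C (1 : ℤ)).map e.inv, ?_⟩
  refine isomorphic_distinguished _ (t.triangleLTGE_distinguished 0 X₃) _ ?_
  refine Triangle.isoMk _ _ e (Iso.refl _) (Iso.refl _) ?_ ?_ ?_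
  · exact Category.comp_id _
  · exact (Category.comp_id _).trans (Category.id_comp _).symm
  · refine Eq.trans ?_ (Category.id_comp _).symm
    exact hδ

/-- The heart of a t-structure is an abelian category. -/
noncomputable instance heartAbelian : Abelian (Hrt t) :=
  AbelianSubcategory.abelian t.heart.ι (heart_hom_eq_zero t) (heart_admissible t)

variable {t} in
/-- The objects of the heart that lie in `C^{w ≤ i}`, as a property of objects of the heart. -/
def heartLE (w : WeightStructure C) (i : ℤ) : ObjectProperty (Hrt t) :=
  fun X ↦ w.le i X.obj

variable {t} in
/-- The objects of the heart that lie in `C^{w ≥ i}`, as a property of objects of the heart. -/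
def heartGE (w : WeightStructure C) (i : ℤ) : ObjectProperty (Hrt t) :=
  fun X ↦ w.ge i X.obj

variable {t} in
/-- `A_i`: the objects of the heart that lie in `C^{w = i} = C^{w ≤ i} ∩ C^{w ≥ i}`. -/
def heartEQ (w : WeightStructure C) (i : ℤ) : ObjectProperty (Hrt t) :=
  fun X ↦ w.le i X.obj ∧ w.ge i X.obj

/-- The cohomology object `X^{τ = j} = τ_{≥ 0} τ_{≤ 0} (X[j])` in the heart of `t`, i.e. the cone
of `τ_{≤ -1} (X[j]) ⟶ τ_{≤ 0} (X[j])`. -/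
noncomputable def coh (j : ℤ) (X : C) : Hrt t :=
  ⟨(t.truncGELE 0 0).obj (X⟦j⟧), (t.mem_heart_iff _).2 ⟨inferInstance, inferInstance⟩⟩

end Heart

section Functors

variable {A B : Type*} [Category* A] [Category* B]

/-- A functor is exact if it preserves finite limits and finite colimits. -/
def IsExact (F : A ⥤ B) : Prop :=
  PreservesFiniteLimits F ∧ PreservesFiniteColimits F

/-- The functor `F : A ⥤ A` is a projection of `A` onto the full subcategory of objects
satisfying `P`: it takes its values there, and its restriction there is isomorphic to the
identity. -/
def IsProjectionOnto (F : A ⥤ A) (P : ObjectProperty A) : Prop :=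
  (∀ X, P (F.obj X)) ∧ Nonempty (P.ι ⋙ F ≅ P.ι)

variable [HasZeroMorphisms B] [HasCokernels B]

/-- The objectwise cokernel `X ↦ cokernel (α.app X)` of a natural transformation. -/
noncomputable def cokerFunctor {F G : A ⥤ B} (α : F ⟶ G) : A ⥤ B where
  obj X := cokernel (α.app X)
  map {X Y} f := cokernel.map (α.app X) (α.app Y) (F.map f) (G.map f) (α.naturality f).symm

/-- The projection onto the objectwise cokernel. -/
noncomputable def cokerProj {F G : A ⥤ B} (α : F ⟶ G) : G ⟶ cokerFunctor α where
  app X := cokernel.π (α.app X)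
  naturality X Y f := by simp [cokerFunctor]

end Functors

section WeightFiltration

variable {C : Type u} [Category.{v} C] [Preadditive C] [HasZeroObject C] [HasShift C ℤ]
  [∀ n : ℤ, (shiftFunctor C n).Additive] [Pretriangulated C] [IsTriangulated C]

/-- A functorial (in objects of the heart of `t`) increasing filtration by subobjects
`W_{≤ i} X ⊆ X`, `i ∈ ℤ`, that is separated, exhaustive, and such that
`W_{≤ i} X / W_{≤ i - 1} X` belongs to `A_i` for all `i`. -/
structure WeightFiltration (t : TStructure C) (w : WeightStructure C) where
  /-- the functor `X ↦ W_{≤ i} X` -/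
  W (i : ℤ) : Hrt t ⥤ Hrt t
  /-- the inclusion `W_{≤ i} X ⟶ X` -/
  ι (i : ℤ) : W i ⟶ 𝟭 (Hrt t)
  mono_ι (i : ℤ) (X : Hrt t) : Mono ((ι i).app X)
  /-- the inclusion `W_{≤ i} X ⟶ W_{≤ j} X` for `i ≤ j` -/
  incl {i j : ℤ} (h : i ≤ j) : W i ⟶ W j
  incl_ι {i j : ℤ} (h : i ≤ j) : incl h ≫ ι j = ι i
  /-- `⋂_i W_{≤ i} X = 0` -/
  separated (X : Hrt t) :
    IsGLB (Set.range fun i : ℤ ↦ haveI := mono_ι i X; Subobject.mk ((ι i).app X)) ⊥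
  /-- `⋃_i W_{≤ i} X = X` -/
  exhaustive (X : Hrt t) :
    IsLUB (Set.range fun i : ℤ ↦ haveI := mono_ι i X; Subobject.mk ((ι i).app X)) ⊤
  graded (i j : ℤ) (hij : i + 1 = j) (X : Hrt t) :
    heartEQ w j (cokernel ((incl (show i ≤ j by lia)).app X))

namespace WeightFiltration

variable {t : TStructure C} {w : WeightStructure C} (F : WeightFiltration t w)

/-- The functor `W_{≥ i} : X ↦ X / W_{≤ i - 1} X`. -/
noncomputable def Wge (i : ℤ) : Hrt t ⥤ Hrt t := cokerFunctor (F.ι (i - 1))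

/-- The projection `X ⟶ W_{≥ i} X`. -/
noncomputable def π (i : ℤ) : 𝟭 (Hrt t) ⟶ F.Wge i := cokerProj (F.ι (i - 1))

/-- `Gr_i : X ↦ W_{≥ i} (W_{≤ i} X)`. -/
noncomputable def Gr (i : ℤ) : Hrt t ⥤ Hrt t := F.W i ⋙ F.Wge i

/-- `Gr'_i : X ↦ W_{≤ i} (W_{≥ i} X)`. -/
noncomputable def Gr' (i : ℤ) : Hrt t ⥤ Hrt t := F.Wge i ⋙ F.W i

/-- The projection `W_{≤ i} X ⟶ W_{≥ i} (W_{≤ i} X) = Gr_i X`. -/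
noncomputable def toGr (i : ℤ) : F.W i ⟶ F.Gr i where
  app X := (F.π i).app ((F.W i).obj X)
  naturality _ _ f := (F.π i).naturality ((F.W i).map f)

/-- The inclusion `Gr'_i X = W_{≤ i} (W_{≥ i} X) ⟶ W_{≥ i} X`. -/
noncomputable def fromGr' (i : ℤ) : F.Gr' i ⟶ F.Wge i where
  app X := (F.ι i).app ((F.Wge i).obj X)
  naturality _ _ f := (F.ι i).naturality ((F.Wge i).map f)

/-- The inclusion `W_{≤ i - 1} X ⟶ W_{≤ i} X`. -/
def step (i : ℤ) : F.W (i - 1) ⟶ F.W i := F.incl (by lia)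

end WeightFiltration

end WeightFiltration

end WeightAndT

/-!
Everything rests on two facts.

*Weights in the heart.* The classes `heartLE w i` and `heartGE w i` are closed under subobjects and
quotients in the heart (`heartLE_isClosedUnderSubobjects` and its three companions). A subobject
`Y ⊆ X` of an object of weights `≥ i + 1` has weights `≥ i + 1`: in a decomposition `A ⟶ Y ⟶ B` at
level `i` inside the heart, the composition `A ⟶ Y ⟶ X` vanishes by orthogonality, hence so does
`A ⟶ Y`, and `Y` is a retract of `B`. If `Q` is a quotient of `X` with kernel `K` and `A ⟶ Q ⟶ B` is
such a decomposition, then `A ⟶ Q ⟶ K[1]` vanishes because `K[1]` has weights `≥ i + 2`, so `A ⟶ Q`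
lifts to `X`, where it vanishes. The statements for weights `≤ i` are dual.
Consequently the first terms of the decompositions inside the heart form a functorial filtration,
and a general filtration as in the definition of `WeightFiltration` agrees with it: the graded
pieces of `X` have the weights of `X` as a subquotient and the weight `j` by assumption, so only
finitely many of them are non-zero (separatedness and exhaustiveness are used here), and the
weights of `W_{≤ i} X` and `X / W_{≤ i} X` follow by dévissage (`WeightFiltration.isCutOutBy`).
Exactness, the adjunctions and the statements on graded pieces are then formal consequences,
proved for a subfunctor of the identity of an abelian category that is cut out by two orthogonal
classes closed under subobjects and quotients (`IsCutOutBy`).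

*Weights and truncations.* If `X` has weights `≤ n`, then so does its top cohomology
`H[-m] = τ_{≥ m} X` (`le_truncGE_of_isLE`): in a decomposition `A ⟶ τ_{≥ m} X ⟶ B` obtained by
shifting one inside the heart, the morphism `τ_{≥ m} X ⟶ B` corresponds to a morphism `X ⟶ B`, which
is zero. Then `τ_{≤ m - 1} X` is an extension of `X` by `H[-m-1]`, so it has weights `≤ n` too, and
one proceeds by descending induction on the truncation. Weights `≥ n` are treated dually, starting
from the bottom cohomology. As a bounded object is a finite extension of its shifted cohomology
objects, this also gives the detection of weights by cohomology (`le_iff_coh`, `ge_iff_coh`).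
-/

namespace WeightAndT

/-! ### Weight structures -/

lemma mk_distinguished_of_iso {C : Type u} [Category.{v} C] [Preadditive C] [HasZeroObject C]
    [HasShift C ℤ] [∀ n : ℤ, (shiftFunctor C n).Additive] [Pretriangulated C]
    {A X B A' X' B' : C} {f : A ⟶ X} {g : X ⟶ B} {h : B ⟶ A⟦(1 : ℤ)⟧}
    {f' : A' ⟶ X'} {g' : X' ⟶ B'} {h' : B' ⟶ A'⟦(1 : ℤ)⟧} (hT : Triangle.mk f g h ∈ distTriang C)
    (a : A' ≅ A) (x : X' ≅ X) (b : B' ≅ B) (h₁ : f' ≫ x.hom = a.hom ≫ f)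
    (h₂ : g' ≫ b.hom = x.hom ≫ g) (h₃ : h' ≫ a.hom⟦(1 : ℤ)⟧' = b.hom ≫ h) :
    Triangle.mk f' g' h' ∈ distTriang C :=
  isomorphic_distinguished _ hT _ (Triangle.isoMk _ _ a x b h₁ h₂ h₃)

namespace WeightStructure

variable {C : Type u} [Category.{v} C] [Preadditive C] [HasZeroObject C] [HasShift C ℤ]
  [∀ n : ℤ, (shiftFunctor C n).Additive] [Pretriangulated C] (w : WeightStructure C)

lemma le_of_retract {n : ℤ} {X Y : C} (r : Retract X Y) (hY : w.le n Y) : w.le n X :=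
  (w.le_isStableUnderRetracts n).of_retract r hY

lemma ge_of_retract {n : ℤ} {X Y : C} (r : Retract X Y) (hY : w.ge n Y) : w.ge n X :=
  (w.ge_isStableUnderRetracts n).of_retract r hY

lemma le_of_iso {n : ℤ} {X Y : C} (e : X ≅ Y) (hX : w.le n X) : w.le n Y :=
  w.le_of_retract e.symm.retract hX

lemma ge_of_iso {n : ℤ} {X Y : C} (e : X ≅ Y) (hX : w.ge n X) : w.ge n Y :=
  w.ge_of_retract e.symm.retract hX

lemma le_shift_iff (n a n' : ℤ) (h : n + a = n') (X : C) : w.le n' (X⟦a⟧) ↔ w.le n X :=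
  ⟨fun hX ↦ w.le_of_iso ((shiftEquiv C a).unitIso.symm.app X)
    (w.le_shift n' (-a) n (by lia) _ hX), w.le_shift n a n' h X⟩

lemma ge_shift_iff (n a n' : ℤ) (h : n + a = n') (X : C) : w.ge n' (X⟦a⟧) ↔ w.ge n X :=
  ⟨fun hX ↦ w.ge_of_iso ((shiftEquiv C a).unitIso.symm.app X)
    (w.ge_shift n' (-a) n (by lia) _ hX), w.ge_shift n a n' h X⟩

lemma le_mono {i j : ℤ} (h : i ≤ j) {X : C} (hX : w.le i X) : w.le j X := by
  induction j, h using Int.leInduction with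
  | base => exact hX
  | succ n _ ih =>
    rw [← w.le_shift_iff (n + 1) (-n) 1 (by lia)]
    exact w.le_zero_le _ (w.le_shift n (-n) 0 (by lia) X ih)

lemma ge_antitone {i j : ℤ} (h : i ≤ j) {X : C} (hX : w.ge j X) : w.ge i X := by
  induction j, h using Int.leInduction with
  | base => exact hX
  | succ n _ ih =>
    refine ih ?_
    rw [← w.ge_shift_iff n (-n) 0 (by lia)]
    exact w.ge_one_le _ (w.ge_shift (n + 1) (-n) 1 (by lia) X hX)

lemma hom_eq_zero {i j : ℤ} (h : i < j) {X Y : C} (hX : w.le i X) (hY : w.ge j Y) (f : X ⟶ Y) :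
    f = 0 := by
  refine (shiftFunctor C (-i)).map_injective ?_
  rw [Functor.map_zero]
  exact w.zero _ (w.le_shift i (-i) 0 (by lia) X hX)
    (w.ge_antitone (show 1 ≤ j - i by lia) (w.ge_shift j (-i) (j - i) (by lia) Y hY))

/-- Weight decompositions exist in every degree. -/
lemma exists_triangle (i : ℤ) (X : C) : ∃ (A B : C) (f : A ⟶ X) (g : X ⟶ B) (h : B ⟶ A⟦(1 : ℤ)⟧),
    Triangle.mk f g h ∈ distTriang C ∧ w.le i A ∧ w.ge (i + 1) B := by
  obtain ⟨A, B, hA, hB, f, g, h, mem⟩ := w.exists_triangle_zero_one (X⟦-i⟧)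
  let e : (X⟦-i⟧)⟦i⟧ ≅ X := (shiftEquiv C i).counitIso.app X
  obtain ⟨f', g', h', mem'⟩ : ∃ (f' : A⟦i⟧ ⟶ (X⟦-i⟧)⟦i⟧) (g' : (X⟦-i⟧)⟦i⟧ ⟶ B⟦i⟧)
      (h' : B⟦i⟧ ⟶ (A⟦i⟧)⟦(1 : ℤ)⟧), Triangle.mk f' g' h' ∈ distTriang C :=
    ⟨_, _, _, Triangle.shift_distinguished _ mem i⟩
  exact ⟨A⟦i⟧, B⟦i⟧, f' ≫ e.hom, e.inv ≫ g', h',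
    mk_distinguished_of_iso mem' (Iso.refl _) e.symm (Iso.refl _) (by simp) (by simp) (by simp),
    w.le_shift 0 i i (by lia) A hA, w.ge_shift 1 i (i + 1) (by lia) B hB⟩

/-- `C^{w ≤ i}` is the left orthogonal of `C^{w ≥ i + 1}`. -/
lemma le_iff_orthogonal (i : ℤ) (X : C) :
    w.le i X ↔ ∀ (Y : C) (f : X ⟶ Y), w.ge (i + 1) Y → f = 0 := by
  refine ⟨fun hX Y f hY ↦ w.hom_eq_zero (by lia) hX hY f, fun H ↦ ?_⟩
  obtain ⟨A, B, f, g, h, mem, hA, hB⟩ := w.exists_triangle i X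
  obtain ⟨s, hs⟩ := Triangle.coyoneda_exact₂ _ mem (𝟙 X) ((Category.id_comp g).trans (H _ g hB))
  exact w.le_of_retract ⟨s, f, hs.symm⟩ hA

/-- `C^{w ≥ i + 1}` is the right orthogonal of `C^{w ≤ i}`. -/
lemma ge_iff_orthogonal (i : ℤ) (Y : C) :
    w.ge (i + 1) Y ↔ ∀ (X : C) (f : X ⟶ Y), w.le i X → f = 0 := by
  refine ⟨fun hY X f hX ↦ w.hom_eq_zero (by lia) hX hY f, fun H ↦ ?_⟩
  obtain ⟨A, B, f, g, h, mem, hA, hB⟩ := w.exists_triangle i Y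
  obtain ⟨s, hs⟩ := Triangle.yoneda_exact₂ _ mem (𝟙 Y) ((Category.comp_id f).trans (H _ f hA))
  exact w.ge_of_retract ⟨g, s, hs.symm⟩ hB

lemma le_of_isZero (i : ℤ) {X : C} (hX : IsZero X) : w.le i X :=
  (w.le_iff_orthogonal i X).2 fun _ _ _ ↦ hX.eq_of_src _ _

lemma ge_of_isZero (i : ℤ) {X : C} (hX : IsZero X) : w.ge i X := by
  obtain ⟨i, rfl⟩ : ∃ j, i = j + 1 := ⟨i - 1, by lia⟩
  exact (w.ge_iff_orthogonal i X).2 fun _ _ _ ↦ hX.eq_of_tgt _ _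

section

variable {X Y Z : C} {f : X ⟶ Y} {g : Y ⟶ Z} {h : Z ⟶ X⟦(1 : ℤ)⟧}
  (hT : Triangle.mk f g h ∈ distTriang C) {i : ℤ}
include hT

lemma le₂ (h₁ : w.le i X) (h₃ : w.le i Z) : w.le i Y := by
  rw [le_iff_orthogonal]
  intro U p hU
  obtain ⟨q, hq⟩ := Triangle.yoneda_exact₂ _ hT p (w.hom_eq_zero (by lia) h₁ hU _)
  obtain rfl : q = 0 := w.hom_eq_zero (show i < i + 1 by lia) h₃ hU q
  exact hq.trans comp_zero

lemma ge₂ (h₁ : w.ge i X) (h₃ : w.ge i Z) : w.ge i Y := by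
  obtain ⟨i, rfl⟩ : ∃ j, i = j + 1 := ⟨i - 1, by lia⟩
  rw [ge_iff_orthogonal]
  intro U p hU
  obtain ⟨q, hq⟩ := Triangle.coyoneda_exact₂ _ hT p (w.hom_eq_zero (by lia) hU h₃ _)
  obtain rfl : q = 0 := w.hom_eq_zero (show i < i + 1 by lia) hU h₁ q
  exact hq.trans zero_comp

lemma le₁ (h₂ : w.le i Y) (h₃ : w.le (i + 1) Z) : w.le i X :=
  w.le₂ (inv_rot_of_distTriang _ hT) (w.le_shift (i + 1) (-1) i (by lia) _ h₃) h₂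

lemma ge₃ (h₁ : w.ge (i - 1) X) (h₂ : w.ge i Y) : w.ge i Z :=
  w.ge₂ (rot_of_distTriang _ hT) h₂ (w.ge_shift (i - 1) 1 i (by lia) _ h₁)

end

end WeightStructure

/-! ### Short exact sequences in the heart and distinguished triangles -/

section Heart

variable {C : Type u} [Category.{v} C] [Preadditive C] [HasZeroObject C] [HasShift C ℤ]
  [∀ n : ℤ, (shiftFunctor C n).Additive] [Pretriangulated C] [IsTriangulated C] {t : TStructure C}

lemma exists_shortExact_of_distTriang {A X B : C} {f : A ⟶ X} {g : X ⟶ B} {h : B ⟶ A⟦(1 : ℤ)⟧}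
    (hT : Triangle.mk f g h ∈ distTriang C) (hA : t.heart A) (hX : t.heart X) (hB : t.heart B) :
    ∃ (zero : (ObjectProperty.homMk f : (⟨A, hA⟩ : Hrt t) ⟶ ⟨X, hX⟩) ≫
        (ObjectProperty.homMk g : (⟨X, hX⟩ : Hrt t) ⟶ ⟨B, hB⟩) = 0),
      (ShortComplex.mk _ _ zero).ShortExact := by
  let f' : (⟨A, hA⟩ : Hrt t) ⟶ ⟨X, hX⟩ := ObjectProperty.homMk f
  let g' : (⟨X, hX⟩ : Hrt t) ⟶ ⟨B, hB⟩ := ObjectProperty.homMk g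
  have zero : f' ≫ g' = 0 := by
    ext
    exact comp_distTriang_mor_zero₁₂ _ hT
  have hk := AbelianSubcategory.isLimitKernelForkOfDistTriang (ι := t.heart.ι)
    (heart_hom_eq_zero t) f' g' h hT
  have hc := AbelianSubcategory.isColimitCokernelCoforkOfDistTriang (ι := t.heart.ι)
    (heart_hom_eq_zero t) f' g' h hT
  refine ⟨zero, ?_⟩
  exact
    { exact := ShortComplex.exact_of_f_is_kernel _ hk
      mono_f := mono_of_isLimit_fork hk
      epi_g := epi_of_isColimit_cofork hc }

lemma exists_distTriang_of_shortExact {S : ShortComplex (Hrt t)} (hS : S.ShortExact) :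
    ∃ δ : S.X₃.obj ⟶ (S.X₁.obj)⟦(1 : ℤ)⟧, Triangle.mk S.f.hom S.g.hom δ ∈ distTriang C := by
  have := hS.epi_g
  obtain ⟨K, i, δ, hT⟩ := AbelianSubcategory.exists_distinguished_triangle_of_epi
    (ι := t.heart.ι) (heart_hom_eq_zero t) (heart_admissible t) S.g
  have hk := AbelianSubcategory.isLimitKernelForkOfDistTriang (ι := t.heart.ι)
    (heart_hom_eq_zero t) i S.g δ hT
  let e : S.X₁ ≅ K := IsLimit.conePointUniqueUpToIso hS.fIsKernel hk
  have he : e.hom ≫ i = S.f :=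
    IsLimit.conePointUniqueUpToIso_hom_comp hS.fIsKernel hk WalkingParallelPair.zero
  let e' : t.heart.ι.obj S.X₁ ≅ t.heart.ι.obj K := t.heart.ι.mapIso e
  refine ⟨δ ≫ e'.inv⟦(1 : ℤ)⟧', mk_distinguished_of_iso hT e' (Iso.refl _) (Iso.refl _) ?_ ?_ ?_⟩
  · exact (Category.comp_id _).trans (congrArg t.heart.ι.map he).symm
  · exact (Category.comp_id _).trans (Category.id_comp _).symm
  · rw [Category.assoc, ← Functor.map_comp, e'.inv_hom_id, CategoryTheory.Functor.map_id, Category.comp_id]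
    exact (Category.id_comp _).symm

end Heart

/-! ### Weights in the heart -/

section Heart

variable {C : Type u} [Category.{v} C] [Preadditive C] [HasZeroObject C] [HasShift C ℤ]
  [∀ n : ℤ, (shiftFunctor C n).Additive] [Pretriangulated C] [IsTriangulated C]
  {t : TStructure C} {w : WeightStructure C}

omit [IsTriangulated C] in
lemma heart_hom_eq_zero_of_weights {i j : ℤ} (h : i < j) {X Y : Hrt t} (hX : heartLE w i X)
    (hY : heartGE w j Y) (f : X ⟶ Y) : f = 0 := by
  ext
  exact w.hom_eq_zero h hX hY _

omit [IsTriangulated C] in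
lemma heart_isZero_of_le_of_ge {i j : ℤ} (h : i < j) {X : Hrt t} (hX : heartLE w i X)
    (hX' : heartGE w j X) : IsZero X := by
  rw [IsZero.iff_id_eq_zero]
  exact heart_hom_eq_zero_of_weights h hX hX' _

omit [IsTriangulated C] in
lemma heart_le_of_isZero {X : Hrt t} (hX : IsZero X) (i : ℤ) : heartLE w i X :=
  w.le_of_isZero i (t.heart.ι.map_isZero hX)

lemma heart_le_of_shortExact {i : ℤ} {S : ShortComplex (Hrt t)} (hS : S.ShortExact)
    (h₁ : heartLE w i S.X₁) (h₃ : heartLE w i S.X₃) : heartLE w i S.X₂ := by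
  obtain ⟨δ, hT⟩ := exists_distTriang_of_shortExact hS
  exact w.le₂ hT h₁ h₃

variable (htw : IsTransversal t w)
include htw

omit [IsTriangulated C] in
lemma heartLE_isClosedUnderQuotients (i : ℤ) :
    (heartLE (t := t) w i).IsClosedUnderQuotients where
  prop_of_epi {X Y} f _ hX := by
    obtain ⟨_, A, B, a, b, c, hT, hA, hB, _, hB'⟩ := htw Y.obj i Y.property
    let b' : Y ⟶ ⟨B, hB'⟩ := ObjectProperty.homMk b
    have hb' : b' = 0 := by
      rw [← cancel_epi f, comp_zero]
      exact heart_hom_eq_zero_of_weights (w := w) (Y := ⟨B, hB'⟩) (show i < i + 1 by lia) hX hB _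
    have hb : b = 0 := congrArg t.heart.ι.map hb'
    obtain ⟨s, hs⟩ := Triangle.coyoneda_exact₂ _ hT (𝟙 Y.obj) ((Category.id_comp b).trans hb)
    exact w.le_of_retract ⟨s, a, hs.symm⟩ hA

omit [IsTriangulated C] in
lemma heartGE_isClosedUnderSubobjects (i : ℤ) :
    (heartGE (t := t) w i).IsClosedUnderSubobjects where
  prop_of_mono {X Y} f _ hY := by
    obtain ⟨_, A, B, a, b, c, hT, hA, hB, hA', _⟩ := htw X.obj (i - 1) X.property
    let a' : (⟨A, hA'⟩ : Hrt t) ⟶ X := ObjectProperty.homMk a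
    have ha' : a' = 0 := by
      rw [← cancel_mono f, zero_comp]
      exact heart_hom_eq_zero_of_weights (w := w) (X := ⟨A, hA'⟩) (show i - 1 < i by lia) hA hY _
    have ha : a = 0 := congrArg t.heart.ι.map ha'
    obtain ⟨s, hs⟩ := Triangle.yoneda_exact₂ _ hT (𝟙 X.obj) ((Category.comp_id a).trans ha)
    exact w.ge_of_retract ⟨b, s, hs.symm⟩ (by simpa using hB)

/-- If `0 ⟶ K ⟶ X ⟶ Q ⟶ 0` is exact with `X` of weights `≤ i`, then `Q` has weights `≤ i`, and
any `K ⟶ B` with `B` of weights `≥ i + 1` extends to `X`, because `Q[-1]` has weights `≤ i - 1`. -/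
lemma heartLE_isClosedUnderSubobjects (i : ℤ) :
    (heartLE (t := t) w i).IsClosedUnderSubobjects where
  prop_of_mono {K X} f _ hX := by
    have := heartLE_isClosedUnderQuotients htw i
    obtain ⟨_, A, B, a, b, c, hT, hA, hB, _, _⟩ := htw K.obj i K.property
    have hS : (ShortComplex.mk f (cokernel.π f) (cokernel.condition f)).ShortExact :=
      { exact := ShortComplex.exact_cokernel f }
    have hQ : heartLE w i (cokernel f) := (heartLE w i).prop_of_epi (cokernel.π f) hX
    obtain ⟨δ, hT'⟩ := exists_distTriang_of_shortExact hS
    obtain ⟨b', hb'⟩ := Triangle.yoneda_exact₂ _ (inv_rot_of_distTriang _ hT') b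
      (w.hom_eq_zero (show i - 1 < i + 1 by lia) (w.le_shift i (-1) (i - 1) (by lia) _ hQ) hB _)
    obtain rfl : b' = 0 := w.hom_eq_zero (show i < i + 1 by lia) hX hB b'
    have hb : b = 0 := hb'.trans comp_zero
    obtain ⟨s, hs⟩ := Triangle.coyoneda_exact₂ _ hT (𝟙 K.obj) ((Category.id_comp b).trans hb)
    exact w.le_of_retract ⟨s, a, hs.symm⟩ hA

/-- If `0 ⟶ K ⟶ X ⟶ Q ⟶ 0` is exact with `X` of weights `≥ i`, then `K` has weights `≥ i`, and
any `A ⟶ Q` with `A` of weights `≤ i - 1` lifts to `X`, because `K[1]` has weights `≥ i + 1`. -/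
lemma heartGE_isClosedUnderQuotients (i : ℤ) :
    (heartGE (t := t) w i).IsClosedUnderQuotients where
  prop_of_epi {X Q} f _ hX := by
    have := heartGE_isClosedUnderSubobjects htw i
    obtain ⟨_, A, B, a, b, c, hT, hA, hB, _, _⟩ := htw Q.obj (i - 1) Q.property
    have hS : (ShortComplex.mk (kernel.ι f) f (kernel.condition f)).ShortExact :=
      { exact := ShortComplex.exact_kernel f }
    have hK : heartGE w i (kernel f) := (heartGE w i).prop_of_mono (kernel.ι f) hX
    obtain ⟨δ, hT'⟩ := exists_distTriang_of_shortExact hS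
    obtain ⟨a', ha'⟩ := Triangle.coyoneda_exact₂ _ (rot_of_distTriang _ hT') a
      (w.hom_eq_zero (show i - 1 < i + 1 by lia) hA (w.ge_shift i 1 (i + 1) (by lia) _ hK) _)
    obtain rfl : a' = 0 := w.hom_eq_zero (show i - 1 < i by lia) hA hX a'
    have ha : a = 0 := ha'.trans zero_comp
    obtain ⟨s, hs⟩ := Triangle.yoneda_exact₂ _ hT (𝟙 Q.obj) ((Category.comp_id a).trans ha)
    exact w.ge_of_retract ⟨b, s, hs.symm⟩ (by simpa using hB)

end Heart

/-! ### Weights and t-truncations -/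

section Truncations

variable {C : Type u} [Category.{v} C] [Preadditive C] [HasZeroObject C] [HasShift C ℤ]
  [∀ n : ℤ, (shiftFunctor C n).Additive] [Pretriangulated C] [IsTriangulated C]
  (t : TStructure C) {w : WeightStructure C}

omit [IsTriangulated C] in
lemma nonempty_shift_truncLE_iso (X : C) (a n n' : ℤ) (h : a + n' = n) :
    Nonempty (((t.truncLE n).obj X)⟦a⟧ ≅ (t.truncLE n').obj (X⟦a⟧)) := by
  obtain ⟨e, -⟩ := t.triangle_iso_exists
    (Triangle.shift_distinguished _ (t.triangleLEGE_distinguished n (n + 1) rfl X) a)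
    (t.triangleLEGE_distinguished n' (n' + 1) rfl (X⟦a⟧)) (Iso.refl (X⟦a⟧)) n' (n' + 1)
    (t.isLE_shift ((t.truncLE n).obj X) n a n')
    (t.isGE_shift ((t.truncGE (n + 1)).obj X) (n + 1) a (n' + 1))
    (inferInstanceAs (t.IsLE ((t.truncLE n').obj (X⟦a⟧)) n'))
    (inferInstanceAs (t.IsGE ((t.truncGE (n' + 1)).obj (X⟦a⟧)) (n' + 1)))
  exact ⟨Triangle.π₁.mapIso e⟩

omit [IsTriangulated C] in
lemma nonempty_shift_truncGE_iso (X : C) (a n n' : ℤ) (h : a + n' = n) :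
    Nonempty (((t.truncGE n).obj X)⟦a⟧ ≅ (t.truncGE n').obj (X⟦a⟧)) := by
  obtain ⟨e, -⟩ := t.triangle_iso_exists
    (Triangle.shift_distinguished _
      (t.triangleLEGE_distinguished (n - 1) n (sub_add_cancel n 1) X) a)
    (t.triangleLEGE_distinguished (n' - 1) n' (sub_add_cancel n' 1) (X⟦a⟧))
    (Iso.refl (X⟦a⟧)) (n' - 1) n'
    (t.isLE_shift ((t.truncLE (n - 1)).obj X) (n - 1) a (n' - 1))
    (t.isGE_shift ((t.truncGE n).obj X) n a n')
    (inferInstanceAs (t.IsLE ((t.truncLE (n' - 1)).obj (X⟦a⟧)) (n' - 1)))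
    (inferInstanceAs (t.IsGE ((t.truncGE n').obj (X⟦a⟧)) n'))
  exact ⟨Triangle.π₃.mapIso e⟩

lemma nonempty_shift_truncGELE_iso (X : C) (j : ℤ) :
    Nonempty (((t.truncGELE j j).obj X)⟦j⟧ ≅ (coh t j X).obj) := by
  obtain ⟨e₁⟩ := nonempty_shift_truncGE_iso t ((t.truncLE j).obj X) j j 0 (by lia)
  obtain ⟨e₂⟩ := nonempty_shift_truncLE_iso t X j j 0 (by lia)
  exact ⟨e₁ ≪≫ (t.truncGE 0).mapIso e₂⟩

/-- The triangle `τ_{≤ i} X ⟶ τ_{≤ j} X ⟶ τ_{≥ j} τ_{≤ j} X ⟶`, where `j = i + 1`. -/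
lemma exists_distTriang_truncLE (X : C) (i j : ℤ) (hij : i + 1 = j) :
    ∃ (f : (t.truncLE i).obj X ⟶ (t.truncLE j).obj X)
      (g : (t.truncLE j).obj X ⟶ (t.truncGELE j j).obj X) (h : _),
      Triangle.mk f g h ∈ distTriang C := by
  have h := t.triangleLEGE_distinguished i j hij ((t.truncLE j).obj X)
  have := t.isIso_truncLE_map_truncLEι_app i j (by lia) X
  let e : (t.truncLE i).obj ((t.truncLE j).obj X) ≅ (t.truncLE i).obj X :=
    asIso ((t.truncLE i).map ((t.truncLEι j).app X))
  exact ⟨e.inv ≫ (t.truncLEι i).app _, _, _ ≫ e.hom⟦(1 : ℤ)⟧',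
    mk_distinguished_of_iso h e.symm (Iso.refl _) (Iso.refl _) (Category.comp_id _)
      ((Category.comp_id _).trans (Category.id_comp _).symm)
      (by
        rw [Category.assoc, ← Functor.map_comp, Iso.symm_hom, e.hom_inv_id,
          CategoryTheory.Functor.map_id, Category.comp_id])⟩

/-- The triangle `τ_{≥ i} τ_{≤ i} X ⟶ τ_{≥ i} X ⟶ τ_{≥ i + 1} X ⟶`. -/
lemma exists_distTriang_truncGE (X : C) (i : ℤ) :
    ∃ (f : (t.truncGELE i i).obj X ⟶ (t.truncGE i).obj X)
      (g : (t.truncGE i).obj X ⟶ (t.truncGE (i + 1)).obj X) (h : _),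
      Triangle.mk f g h ∈ distTriang C := by
  have h := t.triangleLEGE_distinguished i (i + 1) rfl ((t.truncGE i).obj X)
  have := t.isIso_truncGE_map_truncGEπ_app (i + 1) i (by lia) X
  let a : (t.truncGELE i i).obj X ≅ (t.truncLE i).obj ((t.truncGE i).obj X) :=
    (t.truncGELEIsoLEGE i i).app X
  let e : (t.truncGE (i + 1)).obj X ≅ (t.truncGE (i + 1)).obj ((t.truncGE i).obj X) :=
    asIso ((t.truncGE (i + 1)).map ((t.truncGEπ i).app X))
  exact ⟨a.hom ≫ (t.truncLEι i).app _, (t.truncGEπ (i + 1)).app _ ≫ e.inv,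
    e.hom ≫ (t.truncGEδLE i (i + 1) rfl).app _ ≫ a.inv⟦(1 : ℤ)⟧',
    mk_distinguished_of_iso h a (Iso.refl _) e (Category.comp_id _)
      ((Category.assoc _ _ _).trans <|
        (congrArg ((t.truncGEπ (i + 1)).app ((t.truncGE i).obj X) ≫ ·) e.inv_hom_id).trans
          ((Category.comp_id _).trans (Category.id_comp _).symm))
      (by
        rw [Category.assoc, Category.assoc, ← Functor.map_comp, a.inv_hom_id,
          CategoryTheory.Functor.map_id]
        exact congrArg (e.hom ≫ ·) (Category.comp_id _))⟩

variable {t}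

section

variable (htw : IsTransversal t w)
include htw

omit [IsTriangulated C] in
/-- Shifted form of transversality, for objects of `C^{t = m}`. -/
lemma exists_decomposition_of_isLE_of_isGE (Z : C) (m n : ℤ) [t.IsLE Z m] [t.IsGE Z m] :
    ∃ (A B : C) (f : A ⟶ Z) (g : Z ⟶ B) (h : B ⟶ A⟦(1 : ℤ)⟧),
      Triangle.mk f g h ∈ distTriang C ∧ w.le n A ∧ w.ge (n + 1) B ∧ t.IsLE A m ∧ t.IsGE B m := by
  obtain ⟨_, A, B, f, g, h, mem, hA, hB, hA', hB'⟩ := htw (Z⟦m⟧) (n + m)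
    ((t.mem_heart_iff _).2 ⟨t.isLE_shift Z m m 0, t.isGE_shift Z m m 0⟩)
  let e : (Z⟦m⟧)⟦-m⟧ ≅ Z := (shiftEquiv C m).unitIso.symm.app Z
  obtain ⟨f', g', h', mem'⟩ : ∃ (f' : A⟦-m⟧ ⟶ (Z⟦m⟧)⟦-m⟧) (g' : (Z⟦m⟧)⟦-m⟧ ⟶ B⟦-m⟧)
      (h' : B⟦-m⟧ ⟶ (A⟦-m⟧)⟦(1 : ℤ)⟧), Triangle.mk f' g' h' ∈ distTriang C :=
    ⟨_, _, _, Triangle.shift_distinguished _ mem (-m)⟩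
  have := ((t.mem_heart_iff _).1 hA').1
  have := ((t.mem_heart_iff _).1 hB').2
  exact ⟨A⟦-m⟧, B⟦-m⟧, f' ≫ e.hom, e.inv ≫ g', h',
    mk_distinguished_of_iso mem' (Iso.refl _) e.symm (Iso.refl _) (by simp) (by simp) (by simp),
    w.le_shift (n + m) (-m) n (by lia) A hA, w.ge_shift (n + m + 1) (-m) (n + 1) (by lia) B hB,
    t.isLE_shift A 0 (-m) m, t.isGE_shift B 0 (-m) m⟩

/-- The top cohomology of an object of weights `≤ n` has weights `≤ n`. -/
lemma le_truncGE_of_isLE {n : ℤ} {X : C} (hX : w.le n X) (m : ℤ) [t.IsLE X m] :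
    w.le n ((t.truncGE m).obj X) := by
  obtain ⟨A, B, f, g, h, mem, hA, hB, _, _⟩ :=
    exists_decomposition_of_isLE_of_isGE htw ((t.truncGE m).obj X) m n
  obtain rfl : g = 0 := t.from_truncGE_obj_ext
    ((w.hom_eq_zero (show n < n + 1 by lia) hX hB _).trans comp_zero.symm)
  obtain ⟨s, hs⟩ := Triangle.coyoneda_exact₂ _ mem (𝟙 ((t.truncGE m).obj X)) comp_zero
  exact w.le_of_retract ⟨s, f, hs.symm⟩ hA

/-- The bottom cohomology of an object of weights `≥ n` has weights `≥ n`. -/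
lemma ge_truncLE_of_isGE {n : ℤ} {X : C} (hX : w.ge n X) (m : ℤ) [t.IsGE X m] :
    w.ge n ((t.truncLE m).obj X) := by
  obtain ⟨n, rfl⟩ : ∃ k, n = k + 1 := ⟨n - 1, by lia⟩
  obtain ⟨A, B, f, g, h, mem, hA, hB, _, _⟩ :=
    exists_decomposition_of_isLE_of_isGE htw ((t.truncLE m).obj X) m n
  obtain rfl : f = 0 := t.to_truncLE_obj_ext
    ((w.hom_eq_zero (show n < n + 1 by lia) hA hX _).trans zero_comp.symm)
  obtain ⟨s, hs⟩ := Triangle.yoneda_exact₂ _ mem (𝟙 ((t.truncLE m).obj X)) zero_comp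
  exact w.ge_of_retract ⟨g, s, hs.symm⟩ hB

end

/-- A class of objects which is closed under extensions and isomorphisms and contains the zero
objects and all the `τ_{≥ j} τ_{≤ j} X` contains the object `X` itself, if `t` is bounded. -/
lemma prop_of_truncGELE (ht : IsBoundedT t) (P : ObjectProperty C) [P.IsClosedUnderIsomorphisms]
    (hP₀ : ∀ Y, IsZero Y → P Y)
    (hP₂ : ∀ ⦃A Y B : C⦄ (f : A ⟶ Y) (g : Y ⟶ B) (h : B ⟶ A⟦(1 : ℤ)⟧),
      Triangle.mk f g h ∈ distTriang C → P A → P B → P Y)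
    (X : C) (hX : ∀ j : ℤ, P ((t.truncGELE j j).obj X)) : P X := by
  obtain ⟨⟨n, hn⟩, ⟨m, hm⟩⟩ := ht X
  have : t.IsLE X n := ⟨hn⟩
  have : t.IsGE X m := ⟨hm⟩
  have H (i : ℤ) (hi : m - 1 ≤ i) : P ((t.truncLE i).obj X) := by
    induction i, hi using Int.leInduction with
    | base => exact hP₀ _ ((t.isGE_iff_isZero_truncLE_obj (m - 1) m (by lia) X).1 this)
    | succ i _ ih =>
      obtain ⟨f, g, h, mem⟩ := exists_distTriang_truncLE t X i (i + 1) rfl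
      exact hP₂ _ _ _ mem ih (hX (i + 1))
  have := t.isLE_of_le X n (max n (m - 1))
  exact P.prop_of_iso (asIso ((t.truncLEι (max n (m - 1))).app X)) (H _ (le_max_right _ _))

variable (ht : IsBoundedT t) (htw : IsTransversal t w)
include ht htw

/-- Removing the top cohomology `H`, which has weights `≤ n`, from an object of weights `≤ n`
leaves an extension of this object by `H[-1]`. -/
lemma le_truncLE {n : ℤ} {X : C} (hX : w.le n X) (i : ℤ) : w.le n ((t.truncLE i).obj X) := by
  obtain ⟨⟨m, hm⟩, -⟩ := ht X
  have : t.IsLE X m := ⟨hm⟩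
  obtain hi | hi := le_total m i
  · have := t.isLE_of_le X m i
    exact w.le_of_iso (asIso ((t.truncLEι i).app X)).symm hX
  · induction i, hi using Int.leInductionDown with
    | base => exact w.le_of_iso (asIso ((t.truncLEι m).app X)).symm hX
    | pred i _ ih =>
      obtain ⟨f, g, h, mem⟩ := exists_distTriang_truncLE t X (i - 1) i (by lia)
      exact w.le₁ mem ih (w.le_mono (by lia) (le_truncGE_of_isLE htw ih i))

lemma le_truncGELE {n : ℤ} {X : C} (hX : w.le n X) (i : ℤ) :
    w.le n ((t.truncGELE i i).obj X) :=
  le_truncGE_of_isLE htw (le_truncLE ht htw hX i) i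

/-- `τ_{≥ i} X` is a finite extension of the objects `τ_{≥ j} τ_{≤ j} X`. -/
lemma le_truncGE {n : ℤ} {X : C} (hX : w.le n X) (i : ℤ) : w.le n ((t.truncGE i).obj X) := by
  obtain ⟨⟨m, hm⟩, -⟩ := ht X
  have : t.IsLE X m := ⟨hm⟩
  obtain hi | hi := le_total (m + 1) i
  · have := t.isLE_of_le X m (i - 1)
    exact w.le_of_isZero n ((t.isLE_iff_isZero_truncGE_obj (i - 1) i (by lia) X).1 this)
  · induction i, hi using Int.leInductionDown with
    | base => exact w.le_of_isZero n ((t.isLE_iff_isZero_truncGE_obj m (m + 1) rfl X).1 this)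
    | pred i _ ih =>
      obtain ⟨i, rfl⟩ : ∃ j, i = j + 1 := ⟨i - 1, by lia⟩
      rw [add_sub_cancel_right]
      obtain ⟨f, g, h, mem⟩ := exists_distTriang_truncGE t X i
      exact w.le₂ mem (le_truncGELE ht htw hX i) ih

/-- Removing the bottom cohomology `H`, which has weights `≥ n`, from an object of weights `≥ n`
leaves an extension of `H[1]` by this object. -/
lemma ge_truncGE {n : ℤ} {X : C} (hX : w.ge n X) (i : ℤ) : w.ge n ((t.truncGE i).obj X) := by
  obtain ⟨-, ⟨m, hm⟩⟩ := ht X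
  have : t.IsGE X m := ⟨hm⟩
  obtain hi | hi := le_total i m
  · have := t.isGE_of_ge X i m
    exact w.ge_of_iso (asIso ((t.truncGEπ i).app X)) hX
  · induction i, hi using Int.leInduction with
    | base => exact w.ge_of_iso (asIso ((t.truncGEπ m).app X)) hX
    | succ i _ ih =>
      obtain ⟨f, g, h, mem⟩ := exists_distTriang_truncGE t X i
      have : w.ge n ((t.truncGELE i i).obj X) :=
        w.ge_of_iso ((t.truncGELEIsoLEGE i i).app X).symm (ge_truncLE_of_isGE htw ih i)
      exact w.ge₃ mem (w.ge_antitone (by lia) this) ih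

lemma ge_truncGELE {n : ℤ} {X : C} (hX : w.ge n X) (i : ℤ) :
    w.ge n ((t.truncGELE i i).obj X) :=
  w.ge_of_iso ((t.truncGELEIsoLEGE i i).app X).symm
    (ge_truncLE_of_isGE htw (ge_truncGE ht htw hX i) i)

/-- `τ_{≤ i} X` is a finite extension of the objects `τ_{≥ j} τ_{≤ j} X`. -/
lemma ge_truncLE {n : ℤ} {X : C} (hX : w.ge n X) (i : ℤ) : w.ge n ((t.truncLE i).obj X) := by
  obtain ⟨-, ⟨m, hm⟩⟩ := ht X
  have : t.IsGE X m := ⟨hm⟩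
  obtain hi | hi := le_total i (m - 1)
  · have := t.isGE_of_ge X (i + 1) m
    exact w.ge_of_isZero n ((t.isGE_iff_isZero_truncLE_obj i (i + 1) rfl X).1 this)
  · induction i, hi using Int.leInduction with
    | base =>
      exact w.ge_of_isZero n ((t.isGE_iff_isZero_truncLE_obj (m - 1) m (by lia) X).1 this)
    | succ i _ ih =>
      obtain ⟨f, g, h, mem⟩ := exists_distTriang_truncLE t X i (i + 1) rfl
      exact w.ge₂ mem ih (ge_truncGELE ht htw hX (i + 1))

/-- `τ_{≥ j} τ_{≤ j} X` is `X^{τ = j}[-j]`, whose weights are those of `X^{τ = j}`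
lowered by `j`. -/
lemma le_iff_coh (i : ℤ) (X : C) : w.le i X ↔ ∀ j : ℤ, heartLE w (i + j) (coh t j X) := by
  have H (j : ℤ) : heartLE w (i + j) (coh t j X) ↔ w.le i ((t.truncGELE j j).obj X) := by
    obtain ⟨e⟩ := nonempty_shift_truncGELE_iso t X j
    rw [← w.le_shift_iff i j (i + j) rfl]
    exact ⟨w.le_of_iso e.symm, w.le_of_iso e⟩
  simp only [H]
  refine ⟨fun hX j ↦ le_truncGELE ht htw hX j, fun hX ↦ ?_⟩
  have : (w.le i).IsClosedUnderIsomorphisms := ⟨fun e ↦ w.le_of_iso e⟩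
  exact prop_of_truncGELE ht _ (fun _ ↦ w.le_of_isZero i) (fun _ _ _ _ _ _ h ↦ w.le₂ h) X hX

lemma ge_iff_coh (i : ℤ) (X : C) : w.ge i X ↔ ∀ j : ℤ, heartGE w (i + j) (coh t j X) := by
  have H (j : ℤ) : heartGE w (i + j) (coh t j X) ↔ w.ge i ((t.truncGELE j j).obj X) := by
    obtain ⟨e⟩ := nonempty_shift_truncGELE_iso t X j
    rw [← w.ge_shift_iff i j (i + j) rfl]
    exact ⟨w.ge_of_iso e.symm, w.ge_of_iso e⟩
  simp only [H]
  refine ⟨fun hX j ↦ ge_truncGELE ht htw hX j, fun hX ↦ ?_⟩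
  have : (w.ge i).IsClosedUnderIsomorphisms := ⟨fun e ↦ w.ge_of_iso e⟩
  exact prop_of_truncGELE ht _ (fun _ ↦ w.ge_of_isZero i) (fun _ _ _ _ _ _ h ↦ w.ge₂ h) X hX

end Truncations

/-! ### Subfunctors of the identity cut out by orthogonal classes -/

section Abelian

variable {A : Type*} [Category* A] [Abelian A]

lemma exists_mono_cokernel {X Y Z : A} (f : X ⟶ Y) (g : Y ⟶ Z) (h : X ⟶ Z) (fac : f ≫ g = h)
    [Mono g] :
    ∃ m : cokernel f ⟶ cokernel h, Mono m ∧ cokernel.π f ≫ m = g ≫ cokernel.π h := by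
  let m : cokernel f ⟶ cokernel h :=
    cokernel.desc f (g ≫ cokernel.π h) (by rw [reassoc_of% fac, cokernel.condition])
  have hm : cokernel.π f ≫ m = g ≫ cokernel.π h := cokernel.π_desc _ _ _
  refine ⟨m, Preadditive.mono_of_cancel_zero _ fun {T} x hx ↦ ?_, hm⟩
  obtain ⟨T₁, p, _, y, hy⟩ := surjective_up_to_refinements_of_epi (cokernel.π f) x
  obtain ⟨T₂, q, _, z, hz⟩ := (ShortComplex.exact_cokernel h).exact_up_to_refinements (y ≫ g) (by
    dsimp
    rw [Category.assoc, ← hm, ← reassoc_of% hy, hx, comp_zero])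
  have hz' : q ≫ y = z ≫ f := by
    rw [← cancel_mono g, Category.assoc, Category.assoc, fac]
    exact hz
  rw [← cancel_epi p, ← cancel_epi q, hy, reassoc_of% hz', cokernel.condition]
  simp

lemma exact_of_kernel_factors {X Y Z : A} {f : X ⟶ Y} {g : Y ⟶ Z} (zero : f ≫ g = 0)
    (k : kernel g ⟶ X) (fac : k ≫ f = kernel.ι g) : (ShortComplex.mk f g zero).Exact := by
  rw [ShortComplex.exact_iff_exact_up_to_refinements]
  intro T x hx
  refine ⟨T, 𝟙 T, inferInstance, kernel.lift g x hx ≫ k, ?_⟩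
  rw [Category.assoc, fac, kernel.lift_ι, Category.id_comp]

lemma exact_of_cokernel_factors {X Y Z : A} {f : X ⟶ Y} {g : Y ⟶ Z} (zero : f ≫ g = 0)
    (k : Z ⟶ cokernel f) (fac : g ≫ k = cokernel.π f) : (ShortComplex.mk f g zero).Exact := by
  rw [ShortComplex.exact_iff_exact_up_to_refinements]
  intro T x hx
  have hx' : x ≫ cokernel.π f = 0 := by
    rw [← fac, reassoc_of% hx, zero_comp]
  exact (ShortComplex.exact_cokernel f).exact_up_to_refinements x hx'

lemma isExact_of_shortExact (F : A ⥤ A) [F.Additive]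
    (h : ∀ S : ShortComplex A, S.ShortExact →
      Mono (F.map S.f) ∧ (S.map F).Exact ∧ Epi (F.map S.g)) : IsExact F :=
  ⟨F.preservesFiniteLimits_iff_forall_exact_map_and_mono.2 fun S hS ↦
      ⟨(h S hS).2.1, (h S hS).1⟩,
    F.preservesFiniteColimits_iff_forall_exact_map_and_epi.2 fun S hS ↦ (h S hS).2⟩

omit [Abelian A] in
lemma IsExact.comp {F G : A ⥤ A} (hF : IsExact F) (hG : IsExact G) : IsExact (F ⋙ G) := by
  have := hF.1
  have := hF.2
  have := hG.1
  have := hG.2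
  exact ⟨comp_preservesFiniteLimits F G, comp_preservesFiniteColimits F G⟩

/-- A subfunctor `ι : L ⟶ 𝟭 A` of the identity is cut out by a pair `(P, Q)` of classes of objects
if `L` takes its values in `P`, the quotients `X / L X` belong to `Q`, there are no non-zero
morphisms from objects of `P` to objects of `Q`, and both classes are closed under subobjects
and quotients. -/
structure IsCutOutBy {L : A ⥤ A} (ι : L ⟶ 𝟭 A) (P Q : ObjectProperty A) : Prop where
  mono (X : A) : Mono (ι.app X)
  left_sub : P.IsClosedUnderSubobjects
  left_quot : P.IsClosedUnderQuotients
  right_sub : Q.IsClosedUnderSubobjects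
  right_quot : Q.IsClosedUnderQuotients
  left_obj (X : A) : P (L.obj X)
  right_coker (X : A) : Q (cokernel (ι.app X))
  hom_eq_zero ⦃X Y : A⦄ (f : X ⟶ Y) : P X → Q Y → f = 0

namespace IsCutOutBy

variable {L : A ⥤ A} {ι : L ⟶ 𝟭 A} {P Q : ObjectProperty A} (h : IsCutOutBy ι P Q)
include h

lemma exists_lift_of_comp_eq_zero {T X : A} (f : T ⟶ X) (hf : f ≫ cokernel.π (ι.app X) = 0) :
    ∃ g : T ⟶ L.obj X, g ≫ ι.app X = f := by
  have := h.mono X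
  exact ⟨(ShortComplex.exact_cokernel (ι.app X)).lift f hf,
    (ShortComplex.exact_cokernel (ι.app X)).lift_f f hf⟩

lemma exists_lift {T X : A} (f : T ⟶ X) (hT : P T) : ∃ g : T ⟶ L.obj X, g ≫ ι.app X = f :=
  h.exists_lift_of_comp_eq_zero f (h.hom_eq_zero _ hT (h.right_coker X))

lemma exists_desc {X T : A} (f : X ⟶ T) (hT : Q T) :
    ∃ g : cokernel (ι.app X) ⟶ T, cokernel.π (ι.app X) ≫ g = f :=
  ⟨cokernel.desc _ f (h.hom_eq_zero _ (h.left_obj X) hT), cokernel.π_desc _ _ _⟩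

lemma isZero_of_left_right {X : A} (hP : P X) (hQ : Q X) : IsZero X := by
  rw [IsZero.iff_id_eq_zero]
  exact h.hom_eq_zero _ hP hQ

lemma isIso_app_iff (X : A) : IsIso (ι.app X) ↔ P X := by
  have := h.left_quot
  have := h.mono X
  refine ⟨fun _ ↦ P.prop_of_epi (ι.app X) (h.left_obj X), fun hX ↦ ?_⟩
  have : Epi (ι.app X) := Preadditive.epi_of_isZero_cokernel _
    (h.isZero_of_left_right (P.prop_of_epi (cokernel.π (ι.app X)) hX) (h.right_coker X))
  exact isIso_of_mono_of_epi _

lemma isIso_cokernel_π_iff (X : A) : IsIso (cokernel.π (ι.app X)) ↔ Q X := by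
  have := h.right_sub
  refine ⟨fun _ ↦ Q.prop_of_mono (cokernel.π (ι.app X)) (h.right_coker X), fun hX ↦ ?_⟩
  rw [h.hom_eq_zero (ι.app X) (h.left_obj X) hX]
  infer_instance

lemma isZero_obj_iff (X : A) : IsZero (L.obj X) ↔ Q X := by
  have := h.right_sub
  have := h.mono X
  refine ⟨fun hX ↦ ?_, fun hX ↦
    h.isZero_of_left_right (h.left_obj X) (Q.prop_of_mono (ι.app X) hX)⟩
  rw [← h.isIso_cokernel_π_iff, hX.eq_of_src (ι.app X) 0]
  infer_instance

lemma additive : L.Additive where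
  map_add {X Y f g} := by
    have := h.mono Y
    rw [← cancel_mono (ι.app Y), Preadditive.add_comp, ι.naturality, ι.naturality, ι.naturality]
    exact Preadditive.comp_add _ _ _ _ _ _

lemma exact : IsExact L := by
  have := h.additive
  have := h.left_sub
  have := h.right_quot
  refine isExact_of_shortExact L fun S hS ↦ ?_
  have := hS.mono_f
  have := hS.epi_g
  have := h.mono S.X₁
  have := h.mono S.X₂
  have := h.mono S.X₃
  have nat {X Y : A} (f : X ⟶ Y) : L.map f ≫ ι.app Y = ι.app X ≫ f := ι.naturality f
  refine ⟨?_, ?_, ?_⟩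
  · have : Mono (L.map S.f ≫ ι.app S.X₂) := by
      rw [nat]
      infer_instance
    exact mono_of_mono _ (ι.app S.X₂)
  · -- The kernel of `L.map S.g` is a subobject of `S.X₁` which belongs to `P`.
    have hk : (kernel.ι (L.map S.g) ≫ ι.app S.X₂) ≫ S.g = 0 := by
      rw [Category.assoc, ← nat, kernel.condition_assoc, zero_comp]
    obtain ⟨k, hk'⟩ := h.exists_lift (hS.exact.lift _ hk)
      (P.prop_of_mono (kernel.ι (L.map S.g)) (h.left_obj _))
    have fac : k ≫ L.map S.f = kernel.ι (L.map S.g) := by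
      rw [← cancel_mono (ι.app S.X₂), Category.assoc, nat, reassoc_of% hk', hS.exact.lift_f]
    exact exact_of_kernel_factors _ k fac
  · -- The cokernel of `L S.X₂ ⟶ S.X₃` is a quotient of `S.X₂ / L S.X₂`, hence receives no
    -- non-zero morphism from `L S.X₃`.
    have hQ : Q (cokernel (L.map S.g ≫ ι.app S.X₃)) := by
      let p : cokernel (ι.app S.X₂) ⟶ cokernel (L.map S.g ≫ ι.app S.X₃) :=
        cokernel.desc _ (S.g ≫ cokernel.π _) (by
          rw [← Category.assoc, ← nat, cokernel.condition])
      have : Epi (cokernel.π (ι.app S.X₂) ≫ p) := by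
        rw [cokernel.π_desc]
        infer_instance
      have : Epi p := epi_of_epi (cokernel.π (ι.app S.X₂)) p
      exact Q.prop_of_epi p (h.right_coker _)
    rw [epi_iff_surjective_up_to_refinements]
    intro T y
    obtain ⟨T', p, hp, x, hx⟩ := (ShortComplex.exact_cokernel
      (L.map S.g ≫ ι.app S.X₃)).exact_up_to_refinements (y ≫ ι.app S.X₃) (by
        dsimp
        rw [Category.assoc, h.hom_eq_zero (ι.app S.X₃ ≫ _) (h.left_obj _) hQ, comp_zero])
    refine ⟨T', p, hp, x, ?_⟩
    rw [← cancel_mono (ι.app S.X₃), Category.assoc, Category.assoc]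
    exact hx

omit h in
lemma cokernel_π_naturality (ι : L ⟶ 𝟭 A) {X Y : A} (f : X ⟶ Y) :
    cokernel.π (ι.app X) ≫ (cokerFunctor ι).map f = f ≫ cokernel.π (ι.app Y) :=
  ((cokerProj ι).naturality f).symm

omit h in
lemma additive_cokerFunctor (ι : L ⟶ 𝟭 A) : (cokerFunctor ι).Additive where
  map_add {X Y f g} := by
    refine (cancel_epi (cokernel.π (ι.app X))).1 ?_
    refine (cokernel_π_naturality ι (f + g)).trans ?_
    refine Eq.trans ?_ (Preadditive.comp_add _ _ _ _ _ _).symm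
    rw [cokernel_π_naturality, cokernel_π_naturality]
    exact Preadditive.add_comp _ _ _ _ _ _

lemma exact_cokerFunctor : IsExact (cokerFunctor ι) := by
  have := additive_cokerFunctor ι
  have := h.left_sub
  have := h.right_quot
  refine isExact_of_shortExact _ fun S hS ↦ ?_
  have := hS.mono_f
  have := hS.epi_g
  let R := cokerFunctor ι
  let p (X : A) : X ⟶ R.obj X := cokernel.π (ι.app X)
  have hp (X : A) : Epi (p X) := inferInstanceAs (Epi (cokernel.π (ι.app X)))
  have nat {X Y : A} (f : X ⟶ Y) : p X ≫ R.map f = f ≫ p Y := cokernel_π_naturality ι f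
  refine ⟨?_, ?_, ?_⟩
  · -- The kernel of `S.X₁ ⟶ S.X₂ / L S.X₂` is a subobject of `L S.X₂`, hence it maps to zero
    -- in `S.X₁ / L S.X₁`.
    have hP : P (kernel (p S.X₁ ≫ R.map S.f)) := by
      obtain ⟨k, hk⟩ := h.exists_lift_of_comp_eq_zero
        (kernel.ι (p S.X₁ ≫ R.map S.f) ≫ S.f) (by
          change _ ≫ p S.X₂ = 0
          rw [Category.assoc, ← nat, kernel.condition])
      have : Mono (k ≫ ι.app S.X₂) := by
        rw [hk]
        infer_instance
      have : Mono k := mono_of_mono k (ι.app S.X₂)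
      exact P.prop_of_mono k (h.left_obj _)
    refine Preadditive.mono_of_cancel_zero _ fun {T} x hx ↦ ?_
    obtain ⟨T', q, _, y, hy⟩ := surjective_up_to_refinements_of_epi (p S.X₁) x
    have hy' : y ≫ p S.X₁ ≫ R.map S.f = 0 := by
      rw [← reassoc_of% hy, hx, comp_zero]
    rw [← cancel_epi q, comp_zero, hy, ← kernel.lift_ι _ y hy', Category.assoc,
      h.hom_eq_zero (kernel.ι _ ≫ p S.X₁) hP (h.right_coker _), comp_zero]
  · -- The cokernel of `R.map S.f` is a quotient of `S.X₃` which belongs to `Q`.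
    have hk : S.f ≫ p S.X₂ ≫ cokernel.π (R.map S.f) = 0 := by
      rw [← Category.assoc, ← nat, Category.assoc, cokernel.condition, comp_zero]
    obtain ⟨k, hk'⟩ := h.exists_desc (hS.exact.desc _ hk)
      (Q.prop_of_epi (cokernel.π (R.map S.f)) (h.right_coker _))
    have fac : R.map S.g ≫ k = cokernel.π (R.map S.f) := by
      refine (cancel_epi (p S.X₂)).1 ((Category.assoc _ _ _).symm.trans ?_)
      refine (congrArg (· ≫ k) (nat S.g)).trans ((Category.assoc _ _ _).trans ?_)
      exact (congrArg (S.g ≫ ·) hk').trans (hS.exact.g_desc _ hk)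
    exact exact_of_cokernel_factors _ k fac
  · have : Epi (p S.X₂ ≫ R.map S.g) := by
      rw [nat]
      infer_instance
    exact epi_of_epi (p S.X₂) _

/-- An epimorphism `Y ⟶ Z` with kernel in `P` and with `Z` in `Q` identifies `Z` to `Y / L Y`. -/
lemma isIso_desc {Y Z : A} (q : Y ⟶ Z) [Epi q] (hq : P (kernel q)) (zero : ι.app Y ≫ q = 0) :
    IsIso (cokernel.desc (ι.app Y) q zero) := by
  have : Epi (cokernel.π (ι.app Y) ≫ cokernel.desc (ι.app Y) q zero) := by
    rw [cokernel.π_desc]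
    infer_instance
  have : Epi (cokernel.desc (ι.app Y) q zero) := epi_of_epi (cokernel.π (ι.app Y)) _
  have : Mono (cokernel.desc (ι.app Y) q zero) := by
    refine Preadditive.mono_of_cancel_zero _ fun {T} x hx ↦ ?_
    obtain ⟨T', p, _, y, hy⟩ := surjective_up_to_refinements_of_epi (cokernel.π (ι.app Y)) x
    have hy' : y ≫ q = 0 := by
      rw [← cokernel.π_desc (ι.app Y) q zero, ← reassoc_of% hy, hx, comp_zero]
    rw [← cancel_epi p, comp_zero, hy, ← kernel.lift_ι q y hy', Category.assoc,
      h.hom_eq_zero (kernel.ι q ≫ cokernel.π (ι.app Y)) hq (h.right_coker _), comp_zero]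
  exact isIso_of_mono_of_epi _

/-- Functorial form of the uniqueness of quotients in `Q` by subobjects in `P`. -/
lemma exists_iso_cokerFunctor {M G : A ⥤ A} (α : M ⟶ G) [∀ X, Epi (α.app X)]
    (hα : ∀ X, P (kernel (α.app X))) (hG : ∀ X, Q (G.obj X)) :
    ∃ e : M ⋙ cokerFunctor ι ≅ G, Functor.whiskerLeft M (cokerProj ι) ≫ e.hom = α := by
  have zero (X : A) : ι.app (M.obj X) ≫ α.app X = 0 := h.hom_eq_zero _ (h.left_obj _) (hG X)
  have := fun X ↦ h.isIso_desc (α.app X) (hα X) (zero X)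
  have fac (X : A) : cokernel.π (ι.app (M.obj X)) ≫ cokernel.desc _ (α.app X) (zero X) =
      α.app X := cokernel.π_desc _ _ _
  refine ⟨NatIso.ofComponents (fun X ↦ @asIso _ _ _ _ _ (this X)) ?_, ?_⟩
  · intro X Y f
    refine (cancel_epi (cokernel.π (ι.app (M.obj X)))).1 ?_
    refine (Category.assoc _ _ _).symm.trans ?_
    refine (congrArg (· ≫ _) (cokernel_π_naturality ι (M.map f))).trans ?_
    refine (Category.assoc _ _ _).trans ?_
    refine (congrArg (M.map f ≫ ·) (fac Y)).trans ?_
    refine (α.naturality f).trans ?_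
    exact (congrArg (· ≫ G.map f) (fac X).symm).trans (Category.assoc _ _ _)
  · ext X
    exact fac X

lemma exists_adjunction_left : ∃ adj : P.ι ⊣ P.lift L h.left_obj,
    ∀ X : A, adj.counit.app X = ι.app X := by
  have := h.mono
  refine ⟨Adjunction.mkOfHomEquiv
    { homEquiv := fun X Y ↦
        { toFun := fun f ↦ ObjectProperty.homMk (h.exists_lift f X.property).choose
          invFun := fun g ↦ g.hom ≫ ι.app Y
          left_inv := fun f ↦ (h.exists_lift f X.property).choose_spec
          right_inv := fun g ↦ by
            ext
            rw [← cancel_mono (ι.app Y)]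
            exact (h.exists_lift (X := Y) (g.hom ≫ ι.app Y) X.property).choose_spec }
      homEquiv_naturality_left_symm := fun f g ↦ Category.assoc _ _ _
      homEquiv_naturality_right := fun {X Y Y'} f g ↦ by
        ext
        rw [← cancel_mono (ι.app Y')]
        refine (h.exists_lift (X := Y') (f ≫ g) X.property).choose_spec.trans ?_
        refine Eq.trans ?_ (Category.assoc _ _ _).symm
        refine Eq.trans ?_ (congrArg (_ ≫ ·) (ι.naturality g).symm)
        refine Eq.trans ?_ (Category.assoc _ _ _)
        exact congrArg (· ≫ g) (h.exists_lift (X := Y) f X.property).choose_spec.symm },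
    fun X ↦ ?_⟩
  rw [Adjunction.mkOfHomEquiv_counit_app]
  exact Category.id_comp _

lemma exists_adjunction_right : ∃ adj : Q.lift (cokerFunctor ι) h.right_coker ⊣ Q.ι,
    ∀ X : A, adj.unit.app X = (cokerProj ι).app X := by
  refine ⟨Adjunction.mkOfHomEquiv
    { homEquiv := fun X Y ↦
        { toFun := fun f ↦ cokernel.π (ι.app X) ≫ f.hom
          invFun := fun g ↦ ObjectProperty.homMk (h.exists_desc g Y.property).choose
          left_inv := fun f ↦ by
            ext
            refine (cancel_epi (cokernel.π (ι.app X))).1 ?_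
            exact (h.exists_desc (X := X) (cokernel.π (ι.app X) ≫ f.hom) Y.property).choose_spec
          right_inv := fun g ↦ (h.exists_desc g Y.property).choose_spec }
      homEquiv_naturality_right := fun f g ↦ (Category.assoc _ _ _).symm
      homEquiv_naturality_left_symm := fun {X X' Y} f g ↦ by
        ext
        refine (cancel_epi (cokernel.π (ι.app X))).1 ?_
        refine (h.exists_desc (X := X) (f ≫ g) Y.property).choose_spec.trans ?_
        refine Eq.trans ?_ (Category.assoc _ _ _)
        refine Eq.trans ?_ (congrArg (· ≫ _) (cokernel_π_naturality ι f).symm)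
        refine Eq.trans ?_ (Category.assoc _ _ _).symm
        exact congrArg (f ≫ ·) (h.exists_desc (X := X') g Y.property).choose_spec.symm },
    fun X ↦ ?_⟩
  rw [Adjunction.mkOfHomEquiv_unit_app]
  exact Category.comp_id _

end IsCutOutBy

end Abelian

variable {C : Type u} [Category.{v} C] [Preadditive C] [HasZeroObject C] [HasShift C ℤ]
  [∀ n : ℤ, (shiftFunctor C n).Additive] [Pretriangulated C] [IsTriangulated C]
  {t : TStructure C} {w : WeightStructure C}

/-! ### Existence of the weight filtration -/

/-- Transversality in terms of the abelian category structure of the heart. -/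
lemma IsTransversal.exists_mono (htw : IsTransversal t w) (i j : ℤ) (hij : i + 1 = j) (X : Hrt t) :
    ∃ (Y : Hrt t) (a : Y ⟶ X), Mono a ∧ heartLE w i Y ∧ heartGE w j (cokernel a) := by
  subst hij
  obtain ⟨hX, A, B, f, g, h, mem, hA, hB, hA', hB'⟩ := htw X.obj i X.property
  obtain ⟨zero, hS⟩ := exists_shortExact_of_distTriang mem hA' hX hB'
  have := heartGE_isClosedUnderSubobjects htw (i + 1)
  refine ⟨_, _, hS.mono_f, hA, (heartGE w (i + 1)).prop_of_iso
    (IsColimit.coconePointUniqueUpToIso hS.gIsCokernel (colimit.isColimit _)) hB⟩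

lemma IsTransversal.nonempty_weightFiltration (hw : w.IsBounded) (htw : IsTransversal t w) :
    Nonempty (WeightFiltration t w) := by
  choose A a ha hA hA' using fun (i : ℤ) (X : Hrt t) ↦ htw.exists_mono i (i + 1) rfl X
  have exists_lift (i : ℤ) {T X : Hrt t} (f : T ⟶ X) (hT : heartLE w i T) :
      ∃ g : T ⟶ A i X, g ≫ a i X = f :=
    ⟨(ShortComplex.exact_cokernel (a i X)).lift f
      (heart_hom_eq_zero_of_weights (show i < i + 1 by lia) hT (hA' i X) _),
      (ShortComplex.exact_cokernel (a i X)).lift_f _ _⟩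
  choose l hl using fun (i : ℤ) (T X : Hrt t) ↦ exists_lift i (T := T) (X := X)
  have hle {i j : ℤ} (h : i ≤ j) (X : Hrt t) : heartLE w j (A i X) := w.le_mono h (hA i X)
  have hW (i : ℤ) {X Y : Hrt t} (f : X ⟶ Y) :
      l i (A i X) Y (a i X ≫ f) (hA i X) ≫ a i Y = a i X ≫ f := hl _ _ _ _ _
  let W (i : ℤ) : Hrt t ⥤ Hrt t :=
    { obj X := A i X
      map {X Y} f := l i (A i X) Y (a i X ≫ f) (hA i X)
      map_id X := by
        rw [← cancel_mono (a i X), hW, Category.id_comp]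
        exact Category.comp_id _
      map_comp {X Y Z} f g := by
        rw [← cancel_mono (a i Z), hW, Category.assoc, hW, reassoc_of% hW] }
  refine ⟨{
    W := W
    ι i := { app X := a i X, naturality {X Y} f := hW i f }
    mono_ι i X := ha i X
    incl {i j} h :=
      { app X := l j (A i X) X (a i X) (hle h X)
        naturality {X Y} f := by
          have h₁ := hl j (A i X) X (a i X) (hle h X)
          have h₂ := hl j (A i Y) Y (a i Y) (hle h Y)
          rw [← cancel_mono (a j Y)]
          change (l i (A i X) Y (a i X ≫ f) (hA i X) ≫ _) ≫ a j Y =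
            (_ ≫ l j (A j X) Y (a j X ≫ f) (hA j X)) ≫ a j Y
          rw [Category.assoc, h₂, hW, Category.assoc, hW, reassoc_of% h₁] }
    incl_ι {i j} h := by
      ext1; ext1 X
      exact hl j (A i X) X (a i X) (hle h X)
    separated X := ?_
    exhaustive X := ?_
    graded i j hij X := ?_ }⟩
  · obtain ⟨m, hm⟩ := (hw X.obj).2
    refine ⟨fun _ _ ↦ bot_le, fun S hS ↦ (hS ⟨m - 1, rfl⟩).trans (le_of_eq ?_)⟩
    have := ha (m - 1) X
    exact (Subobject.mk_eq_bot_iff_zero (f := a (m - 1) X)).2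
      (heart_hom_eq_zero_of_weights (show m - 1 < m by lia) (hA (m - 1) X) hm _)
  · obtain ⟨n, hn⟩ := (hw X.obj).1
    refine ⟨fun _ _ ↦ le_top, fun S hS ↦ le_trans (le_of_eq ?_) (hS ⟨n, rfl⟩)⟩
    symm
    rw [← Subobject.isIso_iff_mk_eq_top]
    obtain ⟨s, hs⟩ := exists_lift n (𝟙 X) hn
    have := ha n X
    exact ⟨s, by rw [← cancel_mono (a n X), Category.assoc, hs]; simp, hs⟩
  · subst hij
    have := heartLE_isClosedUnderQuotients htw (i + 1)
    have := heartGE_isClosedUnderSubobjects htw (i + 1)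
    have := ha (i + 1) X
    refine ⟨(heartLE w (i + 1)).prop_of_epi (cokernel.π _) (hA (i + 1) X), ?_⟩
    obtain ⟨m, _, -⟩ := exists_mono_cokernel (l (i + 1) (A i X) X (a i X) (hle (by lia) X))
      (a (i + 1) X) (a i X) (hl _ _ _ _ _)
    exact (heartGE w (i + 1)).prop_of_mono m (hA' i X)

/-! ### Weight filtrations are finite, with steps of the expected weights -/

namespace WeightFiltration

variable (F : WeightFiltration t w)

lemma incl_app_ι {i j : ℤ} (h : i ≤ j) (X : Hrt t) :
    (F.incl h).app X ≫ (F.ι j).app X = (F.ι i).app X :=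
  congr_app (F.incl_ι h) X

lemma mono_incl {i j : ℤ} (h : i ≤ j) (X : Hrt t) : Mono ((F.incl h).app X) := by
  have := F.mono_ι i X
  rw [← F.incl_app_ι h] at this
  exact mono_of_mono _ ((F.ι j).app X)

lemma isIso_incl {i j : ℤ} (h : i ≤ j) (X : Hrt t) (hX : IsZero (cokernel ((F.incl h).app X))) :
    IsIso ((F.incl h).app X) := by
  have := F.mono_incl h X
  have := Preadditive.epi_of_isZero_cokernel _ hX
  exact isIso_of_mono_of_epi _

/-- The subobject `W_{≤ i} X` of `X`. -/
noncomputable def sub (i : ℤ) (X : Hrt t) : Subobject X :=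
  have := F.mono_ι i X
  Subobject.mk ((F.ι i).app X)

lemma sub_mono {i j : ℤ} (h : i ≤ j) (X : Hrt t) : F.sub i X ≤ F.sub j X := by
  have := F.mono_ι i X
  have := F.mono_ι j X
  exact Subobject.mk_le_mk_of_comm ((F.incl h).app X) (F.incl_app_ι h X)

lemma sub_le_of_isZero_step (j : ℤ) (X : Hrt t) (h : IsZero ((cokerFunctor (F.step j)).obj X)) :
    F.sub j X ≤ F.sub (j - 1) X := by
  have := F.mono_ι (j - 1) X
  have := F.mono_ι j X
  have : IsIso ((F.step j).app X) := F.isIso_incl _ X h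
  refine Subobject.mk_le_mk_of_comm (inv ((F.step j).app X)) ?_
  rw [IsIso.inv_comp_eq]
  exact (F.incl_app_ι _ X).symm

/-- A weight filtration which is constant above `n` reaches `X` at `n`. -/
lemma isIso_ι_of_isZero_step (n : ℤ) (X : Hrt t)
    (h : ∀ j, n < j → IsZero ((cokerFunctor (F.step j)).obj X)) : IsIso ((F.ι n).app X) := by
  have := F.mono_ι n X
  rw [Subobject.isIso_iff_mk_eq_top, eq_top_iff]
  refine (F.exhaustive X).2 ?_
  rintro _ ⟨i, rfl⟩
  change F.sub i X ≤ F.sub n X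
  obtain hi | hi := le_total i n
  · exact F.sub_mono hi X
  · induction i, hi using Int.leInduction with
    | base => exact le_rfl
    | succ i hi ih =>
      refine le_trans ?_ ih
      simpa using F.sub_le_of_isZero_step (i + 1) X (h _ (by lia))

/-- A weight filtration which is constant below `n` vanishes at `n`. -/
lemma isZero_W_of_isZero_step (n : ℤ) (X : Hrt t)
    (h : ∀ j, j ≤ n → IsZero ((cokerFunctor (F.step j)).obj X)) : IsZero ((F.W n).obj X) := by
  have := F.mono_ι n X
  have h₀ : Subobject.mk ((F.ι n).app X) = ⊥ := by
    rw [eq_bot_iff]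
    refine (F.separated X).2 ?_
    rintro _ ⟨i, rfl⟩
    change F.sub n X ≤ F.sub i X
    obtain hi | hi := le_total n i
    · exact F.sub_mono hi X
    · induction i, hi using Int.leInductionDown with
      | base => exact le_rfl
      | pred i hi ih => exact ih.trans (F.sub_le_of_isZero_step i X (h _ hi))
  rw [Subobject.mk_eq_bot_iff_zero] at h₀
  rw [IsZero.iff_id_eq_zero, ← cancel_mono ((F.ι n).app X), h₀, comp_zero, comp_zero]

lemma heartEQ_step (j : ℤ) (X : Hrt t) : heartEQ w j ((cokerFunctor (F.step j)).obj X) :=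
  F.graded (j - 1) j (by lia) X

section

variable (htw : IsTransversal t w)
include htw

lemma heartLE_W_of_heartLE {n : ℤ} {X : Hrt t} (hX : heartLE w n X) (i : ℤ) :
    heartLE w n ((F.W i).obj X) := by
  have := heartLE_isClosedUnderSubobjects htw n
  have := F.mono_ι i X
  exact (heartLE w n).prop_of_mono ((F.ι i).app X) hX

lemma heartGE_W_of_heartGE {n : ℤ} {X : Hrt t} (hX : heartGE w n X) (i : ℤ) :
    heartGE w n ((F.W i).obj X) := by
  have := heartGE_isClosedUnderSubobjects htw n
  have := F.mono_ι i X
  exact (heartGE w n).prop_of_mono ((F.ι i).app X) hX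

lemma isZero_step_of_heartLE {n : ℤ} {X : Hrt t} (hX : heartLE w n X) (j : ℤ) (hj : n < j) :
    IsZero ((cokerFunctor (F.step j)).obj X) := by
  have := heartLE_isClosedUnderQuotients htw n
  have h := (heartLE w n).prop_of_epi (cokernel.π ((F.step j).app X))
    (F.heartLE_W_of_heartLE htw hX j)
  exact heart_isZero_of_le_of_ge hj h (F.heartEQ_step j X).2

lemma isZero_step_of_heartGE {n : ℤ} {X : Hrt t} (hX : heartGE w n X) (j : ℤ) (hj : j < n) :
    IsZero ((cokerFunctor (F.step j)).obj X) := by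
  have := heartGE_isClosedUnderQuotients htw n
  have h := (heartGE w n).prop_of_epi (cokernel.π ((F.step j).app X))
    (F.heartGE_W_of_heartGE htw hX j)
  exact heart_isZero_of_le_of_ge hj (F.heartEQ_step j X).1 h

variable (hw : w.IsBounded)
include hw

lemma heartLE_W (i : ℤ) (X : Hrt t) : heartLE w i ((F.W i).obj X) := by
  obtain ⟨m, hm⟩ := (hw X.obj).2
  have H (n : ℤ) (hn : n ≤ m - 1) : heartLE w n ((F.W n).obj X) :=
    heart_le_of_isZero (F.isZero_W_of_isZero_step n X
      fun j hj ↦ F.isZero_step_of_heartGE htw hm j (by lia)) n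
  obtain hi | hi := le_total i (m - 1)
  · exact H i hi
  · induction i, hi using Int.leInduction with
    | base => exact H _ le_rfl
    | succ i _ ih =>
      have hi : i ≤ i + 1 := by lia
      have := F.mono_incl hi X
      have hS : (ShortComplex.mk _ _ (cokernel.condition ((F.incl hi).app X))).ShortExact :=
        { exact := ShortComplex.exact_cokernel _ }
      exact heart_le_of_shortExact hS (w.le_mono hi ih) (F.graded i (i + 1) rfl X).1

/-- `W_{≤ i} X` is the largest subobject of `X` of weights `≤ i`. -/
lemma exists_lift_of_heartLE (i : ℤ) {T X : Hrt t} (f : T ⟶ X) (hT : heartLE w i T) :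
    ∃ g : T ⟶ (F.W i).obj X, g ≫ (F.ι i).app X = f := by
  obtain ⟨n, hn⟩ := (hw X.obj).1
  have := F.isIso_ι_of_isZero_step (max i n) X fun j hj ↦
    F.isZero_step_of_heartLE htw hn j (by lia)
  have H (j : ℤ) (hj : j ≤ max i n) (hj' : i ≤ j) :
      ∃ g : T ⟶ (F.W j).obj X, g ≫ (F.ι j).app X = f := by
    induction j, hj using Int.leInductionDown with
    | base => exact ⟨f ≫ inv ((F.ι (max i n)).app X), by simp⟩
    | pred j hj ih =>
      obtain ⟨g, hg⟩ := ih (by lia)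
      have hj : j - 1 ≤ j := by lia
      have := F.mono_incl hj X
      -- The composition `T ⟶ W_{≤ j} X ⟶ W_{≤ j} X / W_{≤ j - 1} X` vanishes since `i < j`.
      have hg' : g ≫ cokernel.π ((F.incl hj).app X) = 0 :=
        heart_hom_eq_zero_of_weights (show i < j by lia) hT (F.graded (j - 1) j (by lia) X).2 _
      refine ⟨(ShortComplex.exact_cokernel ((F.incl hj).app X)).lift g hg', ?_⟩
      rw [← F.incl_app_ι hj, ← hg, ← Category.assoc]
      exact congrArg (· ≫ _) ((ShortComplex.exact_cokernel ((F.incl hj).app X)).lift_f g hg')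
  exact H i (le_max_left _ _) le_rfl

lemma heartGE_cokernel_ι (i j : ℤ) (hij : i + 1 = j) (X : Hrt t) :
    heartGE w j (cokernel ((F.ι i).app X)) := by
  have := heartGE_isClosedUnderQuotients htw j
  obtain ⟨Y, a, _, hY, hY'⟩ := htw.exists_mono i j hij X
  obtain ⟨g, hg⟩ := F.exists_lift_of_heartLE htw hw i a hY
  -- `X / W_{≤ i} X` is a quotient of `X / Y`.
  let p : cokernel a ⟶ cokernel ((F.ι i).app X) :=
    cokernel.desc a (cokernel.π _) (by rw [← hg, Category.assoc, cokernel.condition, comp_zero])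
  have : Epi (cokernel.π a ≫ p) := by
    rw [cokernel.π_desc]
    infer_instance
  have : Epi p := epi_of_epi (cokernel.π a) p
  exact (heartGE w j).prop_of_epi p hY'

lemma isCutOutBy (i j : ℤ) (hij : i + 1 = j) :
    IsCutOutBy (F.ι i) (heartLE w i) (heartGE w j) where
  mono := F.mono_ι i
  left_sub := heartLE_isClosedUnderSubobjects htw i
  left_quot := heartLE_isClosedUnderQuotients htw i
  right_sub := heartGE_isClosedUnderSubobjects htw j
  right_quot := heartGE_isClosedUnderQuotients htw j
  left_obj := F.heartLE_W htw hw i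
  right_coker := F.heartGE_cokernel_ι htw hw i j hij
  hom_eq_zero _ _ f hX hY := heart_hom_eq_zero_of_weights (show i < j by lia) hX hY f

end

end WeightFiltration

/-! ### Graded pieces -/

lemma IsProjectionOnto.of_iso {A : Type*} [Category* A] {F G : A ⥤ A}
    {P : ObjectProperty A} [P.IsClosedUnderIsomorphisms] (h : IsProjectionOnto F P) (e : F ≅ G) : IsProjectionOnto G P :=
  ⟨fun X ↦ P.prop_of_iso (e.app X) (h.1 X), h.2.map (Functor.isoWhiskerLeft P.ι e.symm ≪≫ ·)⟩

instance (i : ℤ) : (heartEQ (t := t) w i).IsClosedUnderIsomorphisms where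
  of_iso e h := ⟨w.le_of_iso (t.heart.ι.mapIso e) h.1, w.ge_of_iso (t.heart.ι.mapIso e) h.2⟩

namespace WeightFiltration

variable (F : WeightFiltration t w) (htw : IsTransversal t w) (hw : w.IsBounded)
include htw hw

lemma exact_W (i : ℤ) : IsExact (F.W i) :=
  (F.isCutOutBy htw hw i (i + 1) rfl).exact

lemma exact_Wge (i : ℤ) : IsExact (F.Wge i) :=
  (F.isCutOutBy htw hw (i - 1) i (by lia)).exact_cokerFunctor

/-- Both `W_{≤ i} X ⟶ Gr'_i X` and `W_{≤ i} X ⟶ W_{≥ i} W_{≤ i} X` are the largest quotients of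
`W_{≤ i} X` of weights `≥ i`. -/
lemma exists_iso_Gr_Gr' (i : ℤ) :
    ∃ e : F.Gr i ≅ F.Gr' i, F.toGr i ≫ e.hom ≫ F.fromGr' i = F.ι i ≫ F.π i := by
  have h := F.isCutOutBy htw hw (i - 1) i (by lia)
  have := h.left_sub
  have := h.right_sub
  have := (F.exact_W htw hw i).2
  have := F.mono_ι i
  have hπ (X : Hrt t) : Epi ((F.π i).app X) :=
    inferInstanceAs (Epi (cokernel.π ((F.ι (i - 1)).app X)))
  let α : F.W i ⟶ F.Gr' i :=
    { app X := (F.W i).map ((F.π i).app X)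
      naturality X Y f := by
        refine ((F.W i).map_comp _ _).symm.trans (Eq.trans ?_ ((F.W i).map_comp _ _))
        exact congrArg (F.W i).map ((F.π i).naturality f) }
  have hα (X : Hrt t) : Epi (α.app X) :=
    inferInstanceAs (Epi ((F.W i).map ((F.π i).app X)))
  have fac (X : Hrt t) : α.app X ≫ (F.fromGr' i).app X = (F.ι i).app X ≫ (F.π i).app X :=
    (F.ι i).naturality ((F.π i).app X)
  have hker (X : Hrt t) : heartLE w (i - 1) (kernel (α.app X)) := by
    -- The kernel of `W_{≤ i} X ⟶ W_{≤ i} W_{≥ i} X` is a subobject of `W_{≤ i - 1} X`.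
    have hk : (kernel.ι (α.app X) ≫ (F.ι i).app X) ≫ (F.π i).app X = 0 :=
      (Category.assoc _ _ _).trans ((congrArg (kernel.ι (α.app X) ≫ ·) (fac X).symm).trans
        ((kernel.condition_assoc _ _).trans zero_comp))
    obtain ⟨g, hg⟩ : ∃ g : kernel (α.app X) ⟶ (F.W (i - 1)).obj X,
        g ≫ (F.ι (i - 1)).app X = kernel.ι (α.app X) ≫ (F.ι i).app X :=
      h.exists_lift_of_comp_eq_zero _ hk
    have : Mono (g ≫ (F.ι (i - 1)).app X) := by
      rw [hg]
      infer_instance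
    have : Mono g := mono_of_mono g ((F.ι (i - 1)).app X)
    exact (heartLE w (i - 1)).prop_of_mono g (h.left_obj X)
  obtain ⟨e, he⟩ := h.exists_iso_cokerFunctor α hker fun X ↦
    F.heartGE_W_of_heartGE htw (h.right_coker X) i
  refine ⟨e, ?_⟩
  ext1; ext1 X
  refine (Category.assoc _ _ _).symm.trans (Eq.trans ?_ (fac X))
  exact congrArg (· ≫ (F.fromGr' i).app X) (congr_app he X)

lemma exists_iso_Gr_step (i : ℤ) :
    ∃ e : F.Gr i ≅ cokerFunctor (F.step i), F.toGr i ≫ e.hom = cokerProj (F.step i) := by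
  have h := F.isCutOutBy htw hw (i - 1) i (by lia)
  have := h.left_quot
  have (X : Hrt t) : Epi ((cokerProj (F.step i)).app X) :=
    inferInstanceAs (Epi (cokernel.π ((F.step i).app X)))
  -- The kernel of `W_{≤ i} X ⟶ W_{≤ i} X / W_{≤ i - 1} X` is the image of `W_{≤ i - 1} X`.
  have hker (X : Hrt t) : heartLE w (i - 1) (Abelian.image ((F.step i).app X)) :=
    (heartLE w (i - 1)).prop_of_epi (Abelian.factorThruImage ((F.step i).app X)) (h.left_obj X)
  exact h.exists_iso_cokerFunctor (cokerProj (F.step i)) hker fun X ↦ (F.heartEQ_step i X).2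

lemma heartEQ_Gr (i : ℤ) (X : Hrt t) : heartEQ w i ((F.Gr i).obj X) := by
  have h := F.isCutOutBy htw hw (i - 1) i (by lia)
  have := heartLE_isClosedUnderQuotients htw i
  have hπ := (heartLE w i).prop_of_epi (cokernel.π ((F.ι (i - 1)).app ((F.W i).obj X)))
    (F.heartLE_W htw hw i X)
  exact ⟨hπ, h.right_coker _⟩

lemma isProjectionOnto_Gr (i : ℤ) : IsProjectionOnto (F.Gr i) (heartEQ w i) := by
  have h := F.isCutOutBy htw hw i (i + 1) rfl
  have h' := F.isCutOutBy htw hw (i - 1) i (by lia)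
  let P : ObjectProperty (Hrt t) := heartEQ w i
  have h₁ (X : P.FullSubcategory) : IsIso ((F.ι i).app X.obj) :=
    (h.isIso_app_iff X.obj).2 X.property.1
  have h₂ (X : P.FullSubcategory) : IsIso ((F.toGr i).app X.obj) :=
    (h'.isIso_cokernel_π_iff _).2 (F.heartGE_W_of_heartGE htw X.property.2 i)
  have : IsIso (Functor.whiskerLeft P.ι (F.ι i)) := by
    have (X : P.FullSubcategory) : IsIso ((Functor.whiskerLeft P.ι (F.ι i)).app X) := h₁ X
    exact NatIso.isIso_of_isIso_app _
  have : IsIso (Functor.whiskerLeft P.ι (F.toGr i)) := by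
    have (X : P.FullSubcategory) : IsIso ((Functor.whiskerLeft P.ι (F.toGr i)).app X) := h₂ X
    exact NatIso.isIso_of_isIso_app _
  exact ⟨F.heartEQ_Gr htw hw i, ⟨(asIso (Functor.whiskerLeft P.ι (F.toGr i))).symm ≪≫
    asIso (Functor.whiskerLeft P.ι (F.ι i))⟩⟩

lemma isZero_Gr_iff (i : ℤ) (X : Hrt t) :
    IsZero ((F.Gr i).obj X) ↔ IsZero ((cokerFunctor (F.step i)).obj X) := by
  obtain ⟨e, -⟩ := F.exists_iso_Gr_step htw hw i
  exact (e.app X).isZero_iff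

lemma heartLE_iff_isZero_Gr (i : ℤ) (X : Hrt t) :
    heartLE w i X ↔ ∀ j, i < j → IsZero ((F.Gr j).obj X) := by
  simp only [F.isZero_Gr_iff htw hw]
  exact ⟨fun hX j hj ↦ F.isZero_step_of_heartLE htw hX j hj, fun hX ↦
    ((F.isCutOutBy htw hw i (i + 1) rfl).isIso_app_iff X).1 (F.isIso_ι_of_isZero_step i X hX)⟩

lemma heartGE_iff_isZero_Gr (i : ℤ) (X : Hrt t) :
    heartGE w i X ↔ ∀ j, j < i → IsZero ((F.Gr j).obj X) := by
  simp only [F.isZero_Gr_iff htw hw]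
  exact ⟨fun hX j hj ↦ F.isZero_step_of_heartGE htw hX j hj, fun hX ↦
    ((F.isCutOutBy htw hw (i - 1) i (by lia)).isZero_obj_iff X).1
      (F.isZero_W_of_isZero_step (i - 1) X fun j hj ↦ hX j (by lia))⟩

end WeightFiltration

end WeightAndT

theorem proposition1p9 {C : Type u} [Category.{v} C] [Preadditive C] [HasZeroObject C]
    [HasShift C ℤ] [∀ n : ℤ, (shiftFunctor C n).Additive] [Pretriangulated C] [IsTriangulated C]
    (t : TStructure C) (w : WeightAndT.WeightStructure C)
    (ht : WeightAndT.IsBoundedT t) (hw : w.IsBounded)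
    (htw : WeightAndT.IsTransversal t w) :
    -- the t-truncations preserve `C^{w ≤ 0}` and `C^{w ≥ 0}`
    (∀ (i : ℤ) (X : C),
      (w.le 0 X → w.le 0 ((t.truncLE i).obj X) ∧ w.le 0 ((t.truncGE i).obj X)) ∧
      (w.ge 0 X → w.ge 0 ((t.truncLE i).obj X) ∧ w.ge 0 ((t.truncGE i).obj X))) ∧
    -- the weight filtration on the heart exists, and it has the following properties
    Nonempty (WeightAndT.WeightFiltration t w) ∧
    ∀ (F : WeightAndT.WeightFiltration t w) (i : ℤ),
      -- weights are detected by the weight filtrations of the cohomology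
      (∀ X : C,
        (w.le i X ↔ ∀ j : ℤ, IsIso ((F.ι (i + j)).app (WeightAndT.coh t j X))) ∧
        (w.ge i X ↔ ∀ j : ℤ, IsZero ((F.W (i + j - 1)).obj (WeightAndT.coh t j X)))) ∧
      -- `W_{≤ i}` is exact, and right adjoint to the inclusion
      (WeightAndT.IsExact (F.W i) ∧
        ∃ (h : ∀ X, WeightAndT.heartLE w i ((F.W i).obj X))
          (adj : (WeightAndT.heartLE w i).ι ⊣ (WeightAndT.heartLE w i).lift (F.W i) h),
          ∀ X : WeightAndT.Hrt t, adj.counit.app X = (F.ι i).app X) ∧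
      -- `W_{≥ i + 1}` is exact, and left adjoint to the inclusion
      (WeightAndT.IsExact (F.Wge (i + 1)) ∧
        ∃ (h : ∀ X, WeightAndT.heartGE w (i + 1) ((F.Wge (i + 1)).obj X))
          (adj : (WeightAndT.heartGE w (i + 1)).lift (F.Wge (i + 1)) h ⊣
            (WeightAndT.heartGE w (i + 1)).ι),
          ∀ X : WeightAndT.Hrt t, adj.unit.app X = (F.π (i + 1)).app X) ∧
      -- `Gr_i` and `Gr'_i` are exact projections onto `A_i`, canonically isomorphic,
      -- and `Gr_i X ≅ W_{≤ i} X / W_{≤ i - 1} X`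
      (WeightAndT.IsExact (F.Gr i) ∧ WeightAndT.IsExact (F.Gr' i) ∧
        WeightAndT.IsProjectionOnto (F.Gr i) (WeightAndT.heartEQ w i) ∧
        WeightAndT.IsProjectionOnto (F.Gr' i) (WeightAndT.heartEQ w i) ∧
        (∃ e : F.Gr i ≅ F.Gr' i, F.toGr i ≫ e.hom ≫ F.fromGr' i = F.ι i ≫ F.π i) ∧
        (∃ e : F.Gr i ≅ WeightAndT.cokerFunctor (F.step i),
          F.toGr i ≫ e.hom = WeightAndT.cokerProj (F.step i))) ∧
      -- the graded pieces detect weights of objects of the heart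
      (∀ X : WeightAndT.Hrt t,
        (w.le i X.obj ↔ ∀ j : ℤ, i < j → IsZero ((F.Gr j).obj X)) ∧
        (w.ge i X.obj ↔ ∀ j : ℤ, j < i → IsZero ((F.Gr j).obj X))) := by

  refine ⟨fun i X ↦
    ⟨fun hX ↦ ⟨WeightAndT.le_truncLE ht htw hX i, WeightAndT.le_truncGE ht htw hX i⟩,
    fun hX ↦ ⟨WeightAndT.ge_truncLE ht htw hX i, WeightAndT.ge_truncGE ht htw hX i⟩⟩,
    htw.nonempty_weightFiltration hw, fun F i ↦ ?_⟩
  have h (i j : ℤ) (hij : i + 1 = j) := F.isCutOutBy htw hw i j hij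
  have hGr : WeightAndT.IsExact (F.Gr i) := (F.exact_W htw hw i).comp (F.exact_Wge htw hw i)
  have hGr' : WeightAndT.IsExact (F.Gr' i) := (F.exact_Wge htw hw i).comp (F.exact_W htw hw i)
  have hproj := F.isProjectionOnto_Gr htw hw i
  obtain ⟨e, he⟩ := F.exists_iso_Gr_Gr' htw hw i
  refine ⟨fun X ↦ ⟨?_, ?_⟩, ⟨F.exact_W htw hw i, _, (h i (i + 1) rfl).exists_adjunction_left⟩,
    ⟨F.exact_Wge htw hw (i + 1), _, (h (i + 1 - 1) (i + 1) (by lia)).exists_adjunction_right⟩,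
    ⟨hGr, hGr', hproj, hproj.of_iso e, ⟨e, he⟩, F.exists_iso_Gr_step htw hw i⟩,
    fun X ↦ ⟨F.heartLE_iff_isZero_Gr htw hw i X, F.heartGE_iff_isZero_Gr htw hw i X⟩⟩
  · rw [WeightAndT.le_iff_coh ht htw]
    exact forall_congr' fun j ↦ ((h (i + j) _ rfl).isIso_app_iff _).symm
  · rw [WeightAndT.ge_iff_coh ht htw]
    exact forall_congr' fun j ↦ ((h (i + j - 1) (i + j) (by lia)).isZero_obj_iff _).symm
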